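/- Assume $2^{\omega_1}=\omega_2$, and let $\pi:\omega_2\to H(\omega_2)$ be a bijection. Let $\mathcal Y\subseteq P_{\omega_1}(\omega_2)$ be a stationary set of countable subsets of $\omega_2$ that is thin (for every $\beta<\omega_2$ the set $\{a\cap\beta : a\in\mathcal Y\}$ has size at most $\omega_1$) and closed under initial segments ($a\cap\beta\in\mathcal Y$ for $a\in\mathcal Y$, $\beta<\omega_2$). Let $\mathcal A=(H(\omega_2),\in,\pi,\mathcal Y)$, and for $a\subseteq H(\omega_2)$ let $Sk(a)$ be the closure of $a$ under the definable Skolem functions of $\mathcal A$ which choose the least witness in the well-ordering of $H(\omega_2)$ induced by $\pi$. Let $C$ be the set of $\beta<\omega_2$ with $Sk(\beta)\cap\omega_2=\beta$, let $\Lambda$ be the set of $\beta<\omega_2$ of cofinality $\omega_1$ which are limit points of $C$, and let $\mathcal X$ be the set of $M\in\mathcal Y$ such that $Sk(M)\cap\omega_2=M$ and $\sup(C\cap\gamma)\in M$ for all $\gamma\in M$. For $M\in\mathcal X$ let $\Lambda_M$ be the set of $\beta\in\Lambda$ with $\beta=\min(\Lambda\setminus\sup(M\cap\beta))$, and for $M,N\in\mathcal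 X$ let $\beta_{M,N}$ be the largest element of $\Lambda_M\cap\Lambda_N$. A set $A\subseteq\mathcal X$ is adequate if for all $M,N\in A$ either $M\cap\beta_{M,N}=N\cap\beta_{M,N}$, or $M\cap\beta_{M,N}\in Sk(N)$, or $N\cap\beta_{M,N}\in Sk(M)$. Let $\mathbb P$ be the forcing poset whose conditions are the pairs $(f,A)$ such that $f$ is a finite partial function from $\omega_2$ to $\omega_2$, $A$ is a finite adequate set, and for all $M\in A$ and $\alpha\in\mathrm{dom}(f)$, if $M$ meets the closed interval whose endpoints are $\alpha$ and $f(\alpha)$, then $\alpha,f(\alpha)\in M$. The order is given by $(g,B)\le(f,A)$ iff $A\subseteq B$ and $f\subseteq g$. Then $\mathbb P$ is strongly proper on a stationary set: for all sufficiently large regular cardinals $\theta$ with $\mathbb P\subseteq H(\theta)$, there are stationarily many countable $N\prec H(\theta)$ such that every $p\in N\cap\mathbb P$ has an extension $q\le p$ which is strongly $(N,\mathbb P)$-generic, that is, every dense subset of the poset $N\cap\mathbb P$ is predense in $\mathbb P$ below $q$. In particular, $\mathbb P$ preserves $\omega_1$: every condition forces that $\omega_1$ (of the ground model) is still a cardinal.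 -/

import Mathlib

universe u v

open scoped Cardinal Ordinal


namespace AdequateForcing

/-! ### Coding sets of ordinals as sets of `ZFSet` -/

/-- The set whose elements are exactly the elements of the `u`-small collection `s`
(and `∅` if `s` is a proper class, a case that does not occur below). -/
noncomputable def ofSet (s : Set ZFSet.{u}) : ZFSet.{u} :=
  open Classical in
  if _h : Small.{u} s then ZFSet.range (fun x : s => (x : ZFSet.{u})) else ∅

theorem mem_ofSet {s : Set ZFSet.{u}} (h : Small.{u} s) {x : ZFSet.{u}} :
    x ∈ ofSet s ↔ x ∈ s := by
  simp [ofSet, h]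

/-- A set of ordinals, as a class of von Neumann ordinals. -/
def ordClass (M : Set Ordinal.{u}) : Set ZFSet.{u} := Ordinal.toZFSet '' M

/-- A set of ordinals, as an element of the set-theoretic universe. -/
noncomputable def ordCode (M : Set Ordinal.{u}) : ZFSet.{u} := ofSet (ordClass M)

/-- The ordinals below `ω₂` lying in `S`, that is, `S ∩ ω₂`. -/
def ordTrace (S : Set ZFSet.{u}) : Set Ordinal.{u} := {α | α < ω_ 2 ∧ α.toZFSet ∈ S}

/-! ### The sets `H(θ)` and their elementary substructures -/

/-- `H(θ)`: the sets whose transitive closure has cardinality less than `θ`. -/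
def H (θ : Cardinal.{u}) : Set ZFSet.{u} :=
  {x | ∃ t : ZFSet.{u}, t.IsTransitive ∧ x ⊆ t ∧ t.card < θ}

/-- The relation symbol of the language of set theory. -/
inductive SetRel : ℕ → Type
  | mem : SetRel 2

/-- The language of set theory. -/
def setLang : FirstOrder.Language.{0, 0} := ⟨fun _ => Empty, SetRel⟩

instance setStructure (X : Set ZFSet.{u}) : setLang.Structure X where
  funMap := fun f _ => Empty.elim f
  RelMap := fun r => match r with
    | SetRel.mem => fun x => (x 0 : ZFSet.{u}) ∈ (x 1 : ZFSet.{u})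

/-- `N ≺ (X, ∈)`. -/
def IsElementaryIn (X N : Set ZFSet.{u}) : Prop :=
  ∃ S : setLang.ElementarySubstructure X, N = Subtype.val '' (S : Set X)

/-! ### Club and stationary subsets of `P_{ω₁}(B)` -/

/-- `𝒞` is a club subset of `P_{ω₁}(B)`, the set of countable subsets of `B`. -/
structure IsClubIn {α : Type v} (B : Set α) (𝒞 : Set (Set α)) : Prop where
  subset : ∀ a ∈ 𝒞, a ⊆ B ∧ a.Countable
  unbounded : ∀ a, a ⊆ B → a.Countable → ∃ c ∈ 𝒞, a ⊆ c
  closed : ∀ s : ℕ → Set α, Monotone s → (∀ n, s n ∈ 𝒞) → (⋃ n, s n) ∈ 𝒞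

/-- `S` is a stationary subset of `P_{ω₁}(B)`. -/
structure IsStationaryIn {α : Type v} (B : Set α) (S : Set (Set α)) : Prop where
  subset : ∀ a ∈ S, a ⊆ B ∧ a.Countable
  meets : ∀ 𝒞, IsClubIn B 𝒞 → (S ∩ 𝒞).Nonempty

/-! ### Strong genericity and strong properness

A forcing poset is a preordered type `Q` together with an embedding `e : Q ↪ ZFSet` saying
which set each condition is; thus `q` belongs to a set `N` when `e q ∈ N`. -/

section StrongProper

variable {Q : Type v} [Preorder Q] (e : Q ↪ ZFSet.{u})

/-- The poset `N ∩ Q`. -/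
def inter (N : Set ZFSet.{u}) : Set Q := {q | e q ∈ N}

/-- `D` is a dense subset of the poset `R ⊆ Q`. -/
def IsDenseSubset (R D : Set Q) : Prop := D ⊆ R ∧ ∀ p ∈ R, ∃ d ∈ D, d ≤ p

/-- `D` is predense below `q`: every extension of `q` is compatible with an element of `D`. -/
def IsPredenseBelow (D : Set Q) (q : Q) : Prop :=
  ∀ r ≤ q, ∃ d ∈ D, ∃ t, t ≤ r ∧ t ≤ d

/-- `q` is a strongly `(N, Q)`-generic condition. -/
def IsStronglyGeneric (N : Set ZFSet.{u}) (q : Q) : Prop :=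
  ∀ D : Set Q, IsDenseSubset (inter e N) D → IsPredenseBelow D q

/-- `Q` is strongly proper on a stationary set: for all sufficiently large regular `θ` with
`Q ⊆ H(θ)` there are stationarily many countable `N ≺ H(θ)` such that every condition in `N ∩ Q`
has a strongly `(N, Q)`-generic extension. -/
def StronglyProperOnStationarySet : Prop :=
  ∃ θ₀ : Cardinal.{u}, ∀ θ : Cardinal.{u}, θ₀ ≤ θ → θ.IsRegular → Set.range e ⊆ H θ →
    IsStationaryIn (H θ) {N | N.Countable ∧ IsElementaryIn (H θ) N ∧
      ∀ p ∈ inter e N, ∃ q ≤ p, IsStronglyGeneric e N q}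

end StrongProper

/-! ### Names, the forcing relation and preservation of cardinals -/

/-- `Q`-names: sets of pairs (name, condition), the index types being `u`-small so that these are
the names of the universe `ZFSet.{u}`. -/
inductive Name (Q : Type v) : Type (max (u + 1) v)
  | mk (ι : Type u) (name : ι → Name Q) (cond : ι → Q) : Name Q

section Forcing

variable {Q : Type v} [Preorder Q]

/-- A statement of the forcing language, given by the conditions that force it. -/
abbrev Statement (Q : Type v) := Q → Prop

/-- `p ⊩ x = y`. -/
def forcesEq : Name.{u, v} Q → Name.{u, v} Q → Statement Q
  | ⟨ι, x, a⟩, ⟨κ, y, b⟩ => fun p =>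
    (∀ i : ι, ∀ q ≤ p, q ≤ a i → ∃ r ≤ q, ∃ j : κ, r ≤ b j ∧ forcesEq (x i) (y j) r) ∧
    (∀ j : κ, ∀ q ≤ p, q ≤ b j → ∃ r ≤ q, ∃ i : ι, r ≤ a i ∧ forcesEq (x i) (y j) r)

/-- `p ⊩ x ∈ y`. -/
def forcesMem (x : Name.{u, v} Q) : Name.{u, v} Q → Statement Q
  | ⟨κ, y, b⟩ => fun p => ∀ q ≤ p, ∃ r ≤ q, ∃ j : κ, r ≤ b j ∧ forcesEq x (y j) r

/-- `p ⊩ ¬ φ`. -/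
def fNot (φ : Statement Q) : Statement Q := fun p => ∀ q ≤ p, ¬ φ q

/-- `p ⊩ φ ∧ ψ`. -/
def fAnd (φ ψ : Statement Q) : Statement Q := fun p => φ p ∧ ψ p

/-- `p ⊩ φ ∨ ψ`. -/
def fOr (φ ψ : Statement Q) : Statement Q := fun p => ∀ q ≤ p, ∃ r ≤ q, φ r ∨ ψ r

/-- `p ⊩ φ → ψ`. -/
def fImp (φ ψ : Statement Q) : Statement Q := fun p => ∀ q ≤ p, φ q → ψ q

/-- `p ⊩ φ ↔ ψ`. -/
def fIff (φ ψ : Statement Q) : Statement Q := fAnd (fImp φ ψ) (fImp ψ φ)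

/-- `p ⊩ ∀ x, φ x`. -/
def fAll (φ : Name.{u, v} Q → Statement Q) : Statement Q := fun p => ∀ x, φ x p

/-- `p ⊩ ∃ x, φ x`. -/
def fEx (φ : Name.{u, v} Q → Statement Q) : Statement Q :=
  fun p => ∀ q ≤ p, ∃ r ≤ q, ∃ x, φ x r

/-- `p ⊩ ∀ x ∈ a, φ x`. -/
def fAllMem (a : Name.{u, v} Q) (φ : Name.{u, v} Q → Statement Q) : Statement Q :=
  fAll fun x => fImp (forcesMem x a) (φ x)

/-- `p ⊩ ∃ x ∈ a, φ x`. -/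
def fExMem (a : Name.{u, v} Q) (φ : Name.{u, v} Q → Statement Q) : Statement Q :=
  fEx fun x => fAnd (forcesMem x a) (φ x)

/-- `z = {x, y}`. -/
def fIsUPair (z x y : Name.{u, v} Q) : Statement Q :=
  fAll fun w => fIff (forcesMem w z) (fOr (forcesEq w x) (forcesEq w y))

/-- `z = (x, y) = {{x}, {x, y}}`. -/
def fIsPair (z x y : Name.{u, v} Q) : Statement Q :=
  fAll fun w => fIff (forcesMem w z) (fOr (fIsUPair w x x) (fIsUPair w x y))

/-- `(x, y) ∈ f`. -/
def fPairMem (f x y : Name.{u, v} Q) : Statement Q :=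
  fExMem f fun z => fIsPair z x y

/-- `f` is a function from `a` onto `b`. -/
def fIsSurjection (f a b : Name.{u, v} Q) : Statement Q :=
  fAnd (fAllMem f fun z => fExMem a fun x => fExMem b fun y => fIsPair z x y) <|
  fAnd (fAllMem a fun x => fExMem b fun y => fPairMem f x y) <|
  fAnd (fAll fun x => fAll fun y => fAll fun y' =>
    fImp (fAnd (fPairMem f x y) (fPairMem f x y')) (forcesEq y y')) <|
  fAllMem b fun y => fExMem a fun x => fPairMem f x y

/-- No element of `κ` is the domain of a function onto `κ`. For an ordinal `κ` this says that
`κ` is a cardinal. -/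
def fIsCardinal (κ : Name.{u, v} Q) : Statement Q :=
  fAllMem κ fun a => fAll fun f => fNot (fIsSurjection f a κ)

/-- The canonical (check) name of the von Neumann ordinal `α`. -/
noncomputable def checkOrd [OrderTop Q] (α : Ordinal.{u}) : Name.{u, v} Q :=
  .mk α.ToType (fun i => checkOrd (Ordinal.ToType.toOrd i).1) (fun _ => ⊤)
termination_by α
decreasing_by exact (Ordinal.ToType.toOrd i).2

variable (Q) in
/-- `Q` preserves the cardinal `κ` (an initial ordinal): every condition forces that
`κ` is still a cardinal. -/
def PreservesCardinal [OrderTop Q] (κ : Ordinal.{u}) : Prop :=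
  ∀ p : Q, fIsCardinal (checkOrd κ : Name.{u, v} Q) p

end Forcing

/-! ### The structure `𝒜 = (H(ω₂), ∈, π, 𝒴)` and Skolem hulls -/

section Models

/-- The relation symbols for `𝒜`: membership, the graph of `π`, and the predicate `𝒴`. -/
inductive ARel : ℕ → Type
  | mem : ARel 2
  | graph : ARel 2
  | thin : ARel 1

/-- The language of `𝒜`. -/
def aLang : FirstOrder.Language.{0, 0} := ⟨fun _ => Empty, ARel⟩

/-- The underlying set `H(ω₂)` of `𝒜`. -/
def AUniv (_π : Ordinal.{u} → ZFSet.{u}) (_𝒴 : Set (Set Ordinal.{u})) : Type (u + 1) :=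
  H.{u} (ℵ_ 2)

variable (π : Ordinal.{u} → ZFSet.{u}) (𝒴 : Set (Set Ordinal.{u}))

variable {π 𝒴} in
/-- An element of `𝒜` as a set. -/
def AUniv.val (x : AUniv π 𝒴) : ZFSet.{u} := Subtype.val x

instance aStructure : aLang.Structure (AUniv π 𝒴) where
  funMap := fun f _ => Empty.elim f
  RelMap := fun r => match r with
    | ARel.mem => fun x => (x 0).val ∈ (x 1).val
    | ARel.graph => fun x => ∃ ξ < ω_ 2, (x 0).val = ξ.toZFSet ∧ (x 1).val = π ξ
    | ARel.thin => fun x => ∃ a ∈ 𝒴, (x 0).val = ordCode a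

variable {π 𝒴} in
/-- The well-ordering of `H(ω₂)` induced by the bijection `π : ω₂ → H(ω₂)`. -/
def AUniv.le (x y : AUniv π 𝒴) : Prop :=
  ∃ ξ ζ : Ordinal.{u}, ξ ≤ ζ ∧ ζ < ω_ 2 ∧ π ξ = x.val ∧ π ζ = y.val

variable {π 𝒴} in
/-- `y` is the value at `x` of the Skolem function of `φ`: the least `y` in the
well-ordering given by `π` such that `𝒜 ⊨ φ(x, y)`. -/
def IsSkolemValue {n : ℕ} (φ : aLang.BoundedFormula Empty (n + 1))
    (x : Fin n → AUniv π 𝒴) (y : AUniv π 𝒴) : Prop :=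
  φ.Realize default (Fin.snoc x y : Fin (n + 1) → AUniv π 𝒴) ∧
    ∀ z : AUniv π 𝒴, φ.Realize default (Fin.snoc x z : Fin (n + 1) → AUniv π 𝒴) → y.le z

/-- `S` is closed under the Skolem functions of `𝒜`. -/
def IsSkolemClosed (S : Set ZFSet.{u}) : Prop :=
  ∀ (n : ℕ) (φ : aLang.BoundedFormula Empty (n + 1)) (x : Fin n → AUniv π 𝒴) (y : AUniv π 𝒴),
    (∀ i, (x i).val ∈ S) → IsSkolemValue φ x y → y.val ∈ S

/-- `Sk(a)`, the closure of `a` under the definable Skolem functions of `𝒜`. -/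
def Sk (a : Set ZFSet.{u}) : Set ZFSet.{u} := ⋂₀ {S | a ⊆ S ∧ IsSkolemClosed π 𝒴 S}

/-- `Sk(M)` for a set of ordinals `M`. -/
def SkO (M : Set Ordinal.{u}) : Set ZFSet.{u} := Sk π 𝒴 (ordClass M)

/-- The set `C` of `β < ω₂` with `Sk(β) ∩ ω₂ = β`. -/
def clubC : Set Ordinal.{u} := {β | β < ω_ 2 ∧ ordTrace (SkO π 𝒴 (Set.Iio β)) = Set.Iio β}

/-- The set `Λ` of `β < ω₂` of cofinality `ω₁` that are limit points of `C`. -/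
def Lam : Set Ordinal.{u} :=
  {β | β < ω_ 2 ∧ β.cof = ℵ_ 1 ∧ ∀ γ < β, ∃ δ ∈ clubC π 𝒴, γ < δ ∧ δ < β}

/-- The set `𝒳` of models: `M ∈ 𝒴` with `Sk(M) ∩ ω₂ = M` and `sup(C ∩ γ) ∈ M` for `γ ∈ M`. -/
def models : Set (Set Ordinal.{u}) :=
  {M | M ∈ 𝒴 ∧ ordTrace (SkO π 𝒴 M) = M ∧ ∀ γ ∈ M, sSup (clubC π 𝒴 ∩ Set.Iio γ) ∈ M}

/-- `Γ_M`: the `β ∈ Γ` with `β = min (Γ \ sup (M ∩ β))`. -/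
def gammaSet (Γ M : Set Ordinal.{u}) : Set Ordinal.{u} :=
  {β | IsLeast {γ | γ ∈ Γ ∧ sSup (M ∩ Set.Iio β) ≤ γ} β}

/-- The comparison point `β_{M,N}`, the largest element of `Γ_M ∩ Γ_N`. -/
noncomputable def cmp (Γ M N : Set Ordinal.{u}) : Ordinal.{u} := sSup (gammaSet Γ M ∩ gammaSet Γ N)

/-- `A` is an adequate set of models (with respect to `Γ`). -/
def IsAdequate (Γ : Set Ordinal.{u}) (A : Set (Set Ordinal.{u})) : Prop :=
  A ⊆ models π 𝒴 ∧ ∀ M ∈ A, ∀ N ∈ A,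
    M ∩ Set.Iio (cmp Γ M N) = N ∩ Set.Iio (cmp Γ M N) ∨
    ordCode (M ∩ Set.Iio (cmp Γ M N)) ∈ SkO π 𝒴 N ∨
    ordCode (N ∩ Set.Iio (cmp Γ M N)) ∈ SkO π 𝒴 M

/-! ### The poset adding a function from `ω₂` to `ω₂` -/

/-- The conditions: pairs `(f, A)` where `f` (given by its graph) is a finite partial function from
`ω₂` to `ω₂`, `A` is a finite adequate set (with `Γ = Λ`), and any `M ∈ A` meeting the closed
interval between `α ∈ dom f` and `f(α)` contains both `α` and `f(α)`. -/
@[ext]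
structure Cond where
  f : Set (Ordinal.{u} × Ordinal.{u})
  A : Set (Set Ordinal.{u})
  f_finite : f.Finite
  f_subset : f ⊆ Set.Iio (ω_ 2) ×ˢ Set.Iio (ω_ 2)
  f_functional : ∀ α γ γ', (α, γ) ∈ f → (α, γ') ∈ f → γ = γ'
  A_finite : A.Finite
  A_adequate : IsAdequate π 𝒴 (Lam π 𝒴) A
  meets : ∀ M ∈ A, ∀ α γ, (α, γ) ∈ f → (M ∩ Set.uIcc α γ).Nonempty → α ∈ M ∧ γ ∈ M

/-- `(g, B) ≤ (f, A)` iff `A ⊆ B` and `f ⊆ g`. -/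
instance : PartialOrder (Cond π 𝒴) where
  le p q := q.A ⊆ p.A ∧ q.f ⊆ p.f
  le_refl _ := ⟨subset_rfl, subset_rfl⟩
  le_trans _ _ _ h h' := ⟨h'.1.trans h.1, h'.2.trans h.2⟩
  le_antisymm _ _ h h' := Cond.ext (h'.2.antisymm h.2) (h'.1.antisymm h.1)

/-- The largest condition `(∅, ∅)`. -/
instance : OrderTop (Cond π 𝒴) where
  top :=
    { f := ∅
      A := ∅
      f_finite := Set.finite_empty
      f_subset := Set.empty_subset _
      f_functional := fun _ _ _ h => h.elim
      A_finite := Set.finite_empty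
      A_adequate := ⟨Set.empty_subset _, fun _ h => h.elim⟩
      meets := fun _ h => h.elim }
  le_top _ := ⟨Set.empty_subset _, Set.empty_subset _⟩

/-- The finite partial function `f` as a set of ordered pairs. -/
noncomputable def funCode (f : Set (Ordinal.{u} × Ordinal.{u})) : ZFSet.{u} :=
  ofSet ((fun x => ZFSet.pair x.1.toZFSet x.2.toZFSet) '' f)

/-- The finite family `A` of sets of ordinals as a set of sets. -/
noncomputable def famCode (A : Set (Set Ordinal.{u})) : ZFSet.{u} := ofSet (ordCode '' A)

theorem ofSet_inj {s t : Set ZFSet.{u}} (hs : Small.{u} s) (ht : Small.{u} t)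
    (h : ofSet s = ofSet t) : s = t := by
  ext x
  rw [← mem_ofSet hs, h, mem_ofSet ht]

theorem ordCode_inj {M N : Set Ordinal.{u}} (hM : M ⊆ Set.Iio (ω_ 2)) (hN : N ⊆ Set.Iio (ω_ 2))
    (h : ordCode M = ordCode N) : M = N := by
  have hM' : Small.{u} M := small_subset hM
  have hN' : Small.{u} N := small_subset hN
  exact Ordinal.toZFSet_injective.image_injective
    (ofSet_inj (small_image _ _) (small_image _ _) h)

theorem models_subset {M : Set Ordinal.{u}} (hM : M ∈ models π 𝒴) : M ⊆ Set.Iio (ω_ 2) := by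
  intro α h
  rw [← hM.2.1] at h
  exact h.1

theorem funCode_inj {f g : Set (Ordinal.{u} × Ordinal.{u})} (hf : f.Finite) (hg : g.Finite)
    (h : funCode f = funCode g) : f = g := by
  have hi : Function.Injective
      (fun x : Ordinal.{u} × Ordinal.{u} => ZFSet.pair x.1.toZFSet x.2.toZFSet) := by
    rintro ⟨a, b⟩ ⟨c, d⟩ h
    have h' := ZFSet.pair_inj.1 h
    exact Prod.ext (Ordinal.toZFSet_injective h'.1) (Ordinal.toZFSet_injective h'.2)
  have := hf.to_subtype
  have := hg.to_subtype
  exact hi.image_injective (ofSet_inj (small_image _ _) (small_image _ _) h)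

theorem famCode_inj {A B : Set (Set Ordinal.{u})} (hA : A.Finite) (hB : B.Finite)
    (hA' : A ⊆ models π 𝒴) (hB' : B ⊆ models π 𝒴) (h : famCode A = famCode B) : A = B := by
  have := hA.to_subtype
  have := hB.to_subtype
  have hinj : Set.InjOn ordCode (models π 𝒴) := fun M hM N hN e =>
    ordCode_inj (models_subset π 𝒴 hM) (models_subset π 𝒴 hN) e
  exact (hinj.image_eq_image_iff hA' hB').1 (ofSet_inj (small_image _ _) (small_image _ _) h)

/-- The condition `(f, A)` as the ordered pair of the set `f` and the set `A`. -/
noncomputable def condEmb : Cond π 𝒴 ↪ ZFSet.{u} where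
  toFun p := ZFSet.pair (funCode p.f) (famCode p.A)
  inj' p q h := by
    have h' := ZFSet.pair_inj.1 h
    exact Cond.ext (funCode_inj p.f_finite q.f_finite h'.1)
      (famCode_inj π 𝒴 p.A_finite q.A_finite p.A_adequate.1 q.A_adequate.1 h'.2)

end Models

end AdequateForcing

/-! A condition `q` with `N ∈ q.A` is strongly generic for every `S` that is good for `N` in the
sense of `IsGoodModel`. Given `r ≤ q`, one builds a condition `v` in `S` such that every `d ≤ v` in
`S` is compatible with `r`, the union of `r` and `d` being a condition
(`Setting.exists_extension_of_restriction`). A dense subset of the conditions in `S` contains some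
such `d`.

The condition `v` keeps the pairs of `r.f` inside `N` and those cuts `M ∩ β_{M,N}` that lie in
`Sk(N)`. This alone does not suffice: a new pair of `d` may jump over a point `b` of some `M ∈ r.A`
with `β_{M,N} ≤ b`, and `M` would then have to contain its end points. The ordinals at risk are the
remainder points `ζ = min(N \ b)`. They are finitely many, since a limit of them would be a common
limit point of `M` and `N` above `β_{M,N}`, and they lie in `Λ`, so cutting a model at `ζ` gives a
model. One takes a model `K` in `Sk(N)` that contains the finitely many data and puts `K` and all `K
∩ ζ` into `v`. A pair of `d` straddling `ζ` has an interval meeting `K` at `ζ`, so its lower end is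
in `K ∩ ζ`; hence so is its upper end, a contradiction.

Adequacy of the union rests on `Setting.cut_mem_SkO_cut`: for `η ∈ Λ` and models `L`, `N`, if `L ∈
Sk(N)` then `L ∩ η ∈ Sk(N ∩ η)`. This is where thinness enters, and it lets comparisons be
transported to smaller points of `Λ`.

Stationarity of `𝒴` gives good models: for any finitary operation with countable values, some member
of `𝒴` is the trace of its own hull. Elementarity in `H(θ)` and membership in a given club are also
closure conditions of this kind. For the preservation of `ω₁`, the hull is closed under deciding
values of a name for a function on a countable ordinal; a strongly generic condition then keeps
those values inside the countable hull. -/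

namespace AdequateForcing

/-! ### Closure under finitary operations -/

section Closure

variable {α : Type v} (T : Finset α → Set α)

/-- `S` is closed under the finitary multifunction `T`. -/
def IsClosedUnder (S : Set α) : Prop := ∀ e : Finset α, (e : Set α) ⊆ S → T e ⊆ S

/-- The closure of `a` under `T`. -/
def hull (a : Set α) : Set α := ⋂₀ {S | a ⊆ S ∧ IsClosedUnder T S}

variable {T}

theorem subset_hull (a : Set α) : a ⊆ hull T a := fun _ hx _ hS => hS.1 hx

theorem hull_subset {a S : Set α} (h : a ⊆ S) (hS : IsClosedUnder T S) : hull T a ⊆ S :=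
  fun _ hx => hx S ⟨h, hS⟩

theorem isClosedUnder_hull (a : Set α) : IsClosedUnder T (hull T a) := fun e he _ hx S hS =>
  hS.2 e (fun _ hy => he hy S hS) hx

theorem hull_mono {a b : Set α} (h : a ⊆ b) : hull T a ⊆ hull T b :=
  hull_subset (h.trans (subset_hull b)) (isClosedUnder_hull b)

theorem IsClosedUnder.mono {T' : Finset α → Set α} (h : ∀ e, T e ⊆ T' e) {S : Set α}
    (hS : IsClosedUnder T' S) : IsClosedUnder T S := fun e he => (h e).trans (hS e he)

theorem exists_subset_of_subset_iUnion {ι : Type*} [Nonempty ι] {s : ι → Set α}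
    (hs : Directed (· ⊆ ·) s) (e : Finset α) (he : (e : Set α) ⊆ ⋃ i, s i) :
    ∃ i, (e : Set α) ⊆ s i :=
  hs.exists_mem_subset_of_finset_subset_biUnion he

theorem isClosedUnder_iUnion {ι : Type*} [Nonempty ι] {s : ι → Set α}
    (hs : Directed (· ⊆ ·) s) (h : ∀ i, IsClosedUnder T (s i)) : IsClosedUnder T (⋃ i, s i) := by
  intro e he
  obtain ⟨i, hi⟩ := exists_subset_of_subset_iUnion hs e he
  exact (h i e hi).trans (Set.subset_iUnion s i)

variable (T) in
/-- The stages of the construction of the closure. -/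
def stage (a : Set α) : ℕ → Set α
  | 0 => a
  | n + 1 => stage a n ∪ ⋃ e : Finset (stage a n), T (e.map (Function.Embedding.subtype _))

theorem stage_mono (a : Set α) : Monotone (stage T a) :=
  monotone_nat_of_le_succ fun _ => Set.subset_union_left

theorem hull_subset_stages (a : Set α) : hull T a ⊆ ⋃ n, stage T a n := by
  apply hull_subset
  · exact Set.subset_iUnion (stage T a) 0
  · intro e he
    obtain ⟨n, hn⟩ := exists_subset_of_subset_iUnion (stage_mono a).directed_le e he
    have h : T e ⊆ stage T a (n + 1) := by
      classical
      have : (e.subtype (· ∈ stage T a n)).map (Function.Embedding.subtype _) = e := by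
        rw [Finset.subtype_map]
        exact Finset.filter_true_of_mem fun x hx => hn hx
      intro x hx
      refine Or.inr (Set.mem_iUnion.2 ⟨e.subtype (· ∈ stage T a n), ?_⟩)
      rw [this]
      exact hx
    exact h.trans (Set.subset_iUnion _ _)

theorem mk_finset_le {β : Type v} {κ : Cardinal.{v}} (hκ : ℵ₀ ≤ κ) (h : #β ≤ κ) :
    #(Finset β) ≤ κ := by
  classical
  exact (Cardinal.mk_le_of_surjective List.toFinset_surjective).trans
    ((Cardinal.mk_list_le_max β).trans (max_le hκ h))

theorem mk_iUnion_le_of_le {ι : Type v} {κ : Cardinal.{v}} (hκ : ℵ₀ ≤ κ) (hι : #ι ≤ κ)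
    (f : ι → Set α) (hf : ∀ i, #(f i) ≤ κ) : #(⋃ i, f i) ≤ κ :=
  (Cardinal.mk_iUnion_le_sum_mk).trans ((Cardinal.sum_le_sum _ (fun _ => κ) hf).trans (by
    rw [Cardinal.sum_const']
    exact Cardinal.mul_le_of_le hκ hι le_rfl))

theorem mk_stage_le {κ : Cardinal.{v}} (hκ : ℵ₀ ≤ κ) (hT : ∀ e, (T e).Countable) {a : Set α}
    (ha : #a ≤ κ) (n : ℕ) : #(stage T a n) ≤ κ := by
  induction n with
  | zero => exact ha
  | succ n ih =>
    refine (Cardinal.mk_union_le _ _).trans (Cardinal.add_le_of_le hκ ih ?_)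
    exact mk_iUnion_le_of_le hκ (mk_finset_le hκ ih) _ fun e =>
      (Cardinal.mk_le_aleph0_iff.2 (hT _).to_subtype).trans hκ

theorem mk_hull_le {κ : Cardinal.{v}} (hκ : ℵ₀ ≤ κ) (hT : ∀ e, (T e).Countable) {a : Set α}
    (ha : #a ≤ κ) : #(hull T a) ≤ κ := by
  refine (Cardinal.mk_le_mk_of_subset (hull_subset_stages a)).trans ?_
  have : (⋃ n, stage T a n) = ⋃ n : ULift.{v} ℕ, stage T a n.down := by
    ext x
    simp
  rw [this]
  exact mk_iUnion_le_of_le hκ (by simpa using hκ) _ fun n => mk_stage_le hκ hT ha _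

theorem countable_hull (hT : ∀ e, (T e).Countable) {a : Set α} (ha : a.Countable) :
    (hull T a).Countable :=
  Cardinal.mk_le_aleph0_iff.1 (mk_hull_le le_rfl hT (Cardinal.mk_le_aleph0_iff.2 ha))

/-- The countable sets `a ⊆ B` which are traces of their hulls form a club. -/
theorem isClubIn_trace {β : Type*} (B : Set β) (i : β → α)
    (hT : ∀ e, (T e).Countable) (hi : Set.InjOn i B) :
    IsClubIn B {a | a ⊆ B ∧ a.Countable ∧ {x ∈ B | i x ∈ hull T (i '' a)} ⊆ a} where
  subset a ha := ⟨ha.1, ha.2.1⟩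
  unbounded a ha hc := by
    have hsub : i '' {x ∈ B | i x ∈ hull T (i '' a)} ⊆ hull T (i '' a) := by
      rintro _ ⟨x, hx, rfl⟩
      exact hx.2
    refine ⟨{x ∈ B | i x ∈ hull T (i '' a)}, ⟨fun x hx => hx.1, ?_, fun x hx => ⟨hx.1, ?_⟩⟩,
      fun x hx => ⟨ha hx, subset_hull _ (Set.mem_image_of_mem i hx)⟩⟩
    · exact Set.countable_of_injective_of_countable_image (hi.mono fun x hx => hx.1)
        ((countable_hull hT (hc.image i)).mono hsub)
    · exact hull_subset hsub (isClosedUnder_hull _) hx.2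
  closed s hs h := by
    refine ⟨Set.iUnion_subset fun n => (h n).1, Set.countable_iUnion fun n => (h n).2.1, ?_⟩
    rintro x ⟨hB, hx⟩
    have hd : Monotone fun n => hull T (i '' s n) := fun m n hmn =>
      hull_mono (Set.image_mono (hs hmn))
    have : hull T (i '' ⋃ n, s n) ⊆ ⋃ n, hull T (i '' s n) := by
      refine hull_subset ?_ (isClosedUnder_iUnion hd.directed_le fun n => isClosedUnder_hull _)
      rw [Set.image_iUnion]
      exact Set.iUnion_mono fun n => subset_hull _
    obtain ⟨n, hn⟩ := Set.mem_iUnion.1 (this hx)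
    exact Set.mem_iUnion.2 ⟨n, (h n).2.2 ⟨hB, hn⟩⟩

/-- A club of countable subsets of `B` contains all nonempty countable sets closed under a
suitable finitary multifunction. -/
theorem IsClubIn.exists_closedUnder {B : Set α} {𝒞 : Set (Set α)} (h𝒞 : IsClubIn B 𝒞) :
    ∃ T : Finset α → Set α, (∀ e, (T e).Countable) ∧
      (∀ e : Finset α, (e : Set α) ⊆ B → T e ⊆ B) ∧
      ∀ N ⊆ B, N.Countable → IsClosedUnder T N → N ∈ 𝒞 := by
  classical
  choose! c hc using h𝒞.unbounded
  -- The value at `e` is chosen above the values at all proper subsets. This makes `F` monotone, so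
  -- a closed set is an increasing union of members of `𝒞` along any exhaustion by finite sets.
  let F : Finset α → Set α := Finset.strongInduction fun e ih =>
    c (e ∪ ⋃ e' : {e' // e' ⊂ e}, ih e'.1 e'.2)
  have hF : ∀ e, F e = c (e ∪ ⋃ e' : {e' // e' ⊂ e}, F e'.1) := fun e =>
    Finset.strongInduction_eq _ e
  have key : ∀ e : Finset α, (e : Set α) ⊆ B → F e ∈ 𝒞 ∧
      ((e : Set α) ∪ ⋃ e' : {e' // e' ⊂ e}, F e'.1) ⊆ F e := by
    intro e
    induction e using Finset.strongInduction with
    | H e ih =>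
      intro he
      have hcount : Countable {e' // e' ⊂ e} :=
        (Finite.of_injective (fun e' : {e' // e' ⊂ e} =>
          (⟨e'.1, Finset.mem_powerset.2 e'.2.1⟩ : e.powerset)) fun a b h => by
            ext1; simpa using h).to_countable
      have hsub : ∀ e' : {e' // e' ⊂ e}, F e'.1 ∈ 𝒞 := fun e' =>
        (ih e'.1 e'.2 ((Finset.coe_subset.2 e'.2.1).trans he)).1
      have h1 := hc ((e : Set α) ∪ ⋃ e' : {e' // e' ⊂ e}, F e'.1)
        (Set.union_subset he (Set.iUnion_subset fun e' => (h𝒞.subset _ (hsub e')).1))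
        (e.countable_toSet.union (Set.countable_iUnion fun e' => (h𝒞.subset _ (hsub e')).2))
      rw [← hF] at h1
      exact h1
  -- Outside `B` nothing is known about the chosen `c`, so the value there is set to `∅`.
  refine ⟨fun e => if (e : Set α) ⊆ B then F e else ∅, fun e => ?_, fun e he => ?_,
    fun N hN hNc hcl => ?_⟩
  · dsimp only
    split_ifs with h
    · exact (h𝒞.subset _ (key e h).1).2
    · exact Set.countable_empty
  · simp only [he, if_true]
    exact (h𝒞.subset _ (key e he).1).1
  · have hcl' : ∀ e : Finset α, (e : Set α) ⊆ N → F e ⊆ N := fun e he => by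
      have := hcl e he
      simpa only [he.trans hN, if_true] using this
    obtain ⟨g, hg⟩ : ∃ g : ℕ → Finset α, Monotone g ∧ N = ⋃ n, (g n : Set α) := by
      rcases N.eq_empty_or_nonempty with rfl | hne
      · exact ⟨fun _ => ∅, fun _ _ _ => le_rfl, by simp⟩
      · obtain ⟨f, rfl⟩ := hNc.exists_eq_range hne
        refine ⟨fun n => (Finset.range n).image f, fun m n h => Finset.image_subset_image
          (Finset.range_subset_range.2 h), ?_⟩
        ext x
        simp only [Set.mem_range, Finset.coe_image, Set.mem_iUnion, Set.mem_image,
          Finset.coe_range, Set.mem_Iio]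
        exact ⟨fun ⟨n, hn⟩ => ⟨n + 1, n, n.lt_succ_self, hn⟩, fun ⟨_, m, _, hm⟩ => ⟨m, hm⟩⟩
    have hgN : ∀ n, (g n : Set α) ⊆ N := fun n => hg.2 ▸ Set.subset_iUnion (fun n => (g n : Set α)) n
    have hmono : ∀ e e' : Finset α, e ⊆ e' → (e' : Set α) ⊆ B → F e ⊆ F e' := by
      intro e e' h h'
      rcases h.eq_or_ssubset with rfl | h1
      · exact subset_rfl
      · exact (Set.subset_iUnion (fun e'' : {e'' // e'' ⊂ e'} => F e''.1) ⟨e, h1⟩).trans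
          (Set.subset_union_right.trans (key e' h').2)
    have : N = ⋃ n, F (g n) := by
      apply Set.Subset.antisymm
      · conv_lhs => rw [hg.2]
        exact Set.iUnion_mono fun n =>
          Set.subset_union_left.trans (key _ ((hgN n).trans hN)).2
      · exact Set.iUnion_subset fun n => hcl' _ (hgN n)
    rw [this]
    exact h𝒞.closed _ (fun m n h => hmono _ _ (hg.1 h) ((hgN n).trans hN))
      fun n => (key _ ((hgN n).trans hN)).1

end Closure

/-! ### Smallness and the sets `H(θ)` -/

theorem mem_ofSet' {s : Set ZFSet.{u}} [h : Small.{u} s] {x : ZFSet.{u}} :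
    x ∈ ofSet s ↔ x ∈ s := mem_ofSet h

theorem small_of_subset_Iio {M : Set Ordinal.{u}} {β : Ordinal.{u}} (h : M ⊆ Set.Iio β) :
    Small.{u} (ordClass M) := by
  have : Small.{u} M := small_subset h
  exact small_image _ _

theorem mem_ordCode {M : Set Ordinal.{u}} {β : Ordinal.{u}} (h : M ⊆ Set.Iio β) {x : ZFSet.{u}} :
    x ∈ ordCode M ↔ ∃ α ∈ M, α.toZFSet = x :=
  mem_ofSet (small_of_subset_Iio h)

theorem toZFSet_mem_ordClass {M : Set Ordinal.{u}} {α : Ordinal.{u}} :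
    α.toZFSet ∈ ordClass M ↔ α ∈ M :=
  Ordinal.toZFSet_injective.mem_set_image

theorem toZFSet_mem_ordCode {M : Set Ordinal.{u}} {β : Ordinal.{u}} (h : M ⊆ Set.Iio β)
    {α : Ordinal.{u}} : α.toZFSet ∈ ordCode M ↔ α ∈ M :=
  (mem_ofSet (small_of_subset_Iio h)).trans toZFSet_mem_ordClass

theorem card_ofSet_lt {s : Set ZFSet.{u}} [Small.{u} s] {θ : Cardinal.{u}}
    (h : #s < Cardinal.lift.{u + 1} θ) : (ofSet s).card < θ := by
  rw [← Cardinal.lift_lt.{u, u + 1}, ← ZFSet.cardinalMk_coe_sort]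
  have : ((ofSet s : ZFSet.{u}) : Set ZFSet.{u}) = s := by
    ext x
    exact mem_ofSet'
  refine lt_of_eq_of_lt ?_ h
  exact congrArg (fun s : Set ZFSet.{u} => #s) this

theorem mem_H_of_subset {θ : Cardinal.{u}} {x y : ZFSet.{u}} (h : y ∈ H θ) (hx : x ⊆ y) :
    x ∈ H θ := by
  obtain ⟨t, ht, hy, hc⟩ := h
  exact ⟨t, ht, hx.trans hy, hc⟩

theorem mem_H_of_mem {θ : Cardinal.{u}} {x y : ZFSet.{u}} (h : y ∈ H θ) (hx : x ∈ y) :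
    x ∈ H θ := by
  obtain ⟨t, ht, hy, hc⟩ := h
  exact ⟨t, ht, ht.subset_of_mem (hy hx), hc⟩

theorem H_mono {θ θ' : Cardinal.{u}} (h : θ ≤ θ') : H θ ⊆ H θ' := fun _ ⟨t, ht, hx, hc⟩ =>
  ⟨t, ht, hx, hc.trans_le h⟩

theorem toZFSet_mem_H {α : Ordinal.{u}} (h : α < ω_ 2) : α.toZFSet ∈ H.{u} (ℵ_ 2) := by
  refine ⟨α.toZFSet, (ZFSet.isOrdinal_toZFSet α).isTransitive, subset_rfl, ?_⟩
  rw [Ordinal.card_toZFSet]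
  rwa [← Cardinal.lt_ord, Cardinal.ord_aleph]

theorem ofSet_mem_H {θ : Cardinal.{u}} (hθ : ℵ₀ < θ) (hr : θ.IsRegular) {s : Set ZFSet.{u}} (hs : s.Countable)
    (h : s ⊆ H θ) : ofSet s ∈ H θ := by
  have h' : ∀ x ∈ s, ∃ t : ZFSet.{u}, t.IsTransitive ∧ x ⊆ t ∧ t.card < θ := fun x hx => h hx
  choose! t ht using h'
  have : Countable s := hs
  have : Small.{u} s := Countable.toSmall _
  have hsm : Small.{u} ((⋃ x : s, (t x : Set ZFSet.{u})) ∪ s : Set ZFSet.{u}) := by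
    have : ∀ x : ZFSet.{u}, Small.{u} (x : Set ZFSet.{u}) := fun x => inferInstanceAs (Small.{u} x)
    infer_instance
  refine ⟨ofSet ((⋃ x : s, (t x : Set ZFSet.{u})) ∪ s), ?_, ?_, card_ofSet_lt ?_⟩
  · intro y hy z hz
    rw [mem_ofSet'] at hy ⊢
    rcases hy with hy | hy
    · obtain ⟨x, hx⟩ := Set.mem_iUnion.1 hy
      exact Or.inl (Set.mem_iUnion.2 ⟨x, (ht x.1 x.2).1.subset_of_mem hx hz⟩)
    · exact Or.inl (Set.mem_iUnion.2 ⟨⟨y, hy⟩, (ht y hy).2.1 hz⟩)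
  · intro y hy
    rw [mem_ofSet'] at hy ⊢
    exact Or.inr hy
  · have hr' := Cardinal.IsRegular.lift.{u + 1, u} hr
    have hlt : ℵ₀ < Cardinal.lift.{u + 1} θ := by simpa using hθ
    have hs' : #s < Cardinal.lift.{u + 1} θ := (Cardinal.mk_le_aleph0_iff.2 ‹_›).trans_lt hlt
    refine (Cardinal.mk_union_le _ _).trans_lt (Cardinal.add_lt_of_lt hlt.le ?_ hs')
    rw [Cardinal.card_iUnion_lt_iff_forall_of_isRegular hr' hs']
    intro x
    have := (ht x.1 x.2).2.2
    rw [← Cardinal.lift_lt.{u, u + 1}, ← ZFSet.cardinalMk_coe_sort] at this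
    exact this


/-! ### Definable predicates of the structure `𝒜` -/

section Definability

open FirstOrder FirstOrder.Language

variable {π : Ordinal.{u} → ZFSet.{u}} {𝒴 : Set (Set Ordinal.{u})}

/-- A predicate of finitely many of the variables `v 0, v 1, …` defined by a formula. -/
def Dfn (P : (ℕ → AUniv π 𝒴) → Prop) : Prop :=
  ∃ φ : aLang.Formula ℕ, ∀ v, φ.Realize v ↔ P v

theorem Dfn.mem (i j : ℕ) : Dfn fun v : ℕ → AUniv π 𝒴 => (v i).val ∈ (v j).val :=
  ⟨Relations.formula₂ (L := aLang) ARel.mem (Term.var i) (Term.var j), fun _ =>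
    Formula.realize_rel₂ (L := aLang)⟩

theorem Dfn.graph (i j : ℕ) :
    Dfn fun v : ℕ → AUniv π 𝒴 => ∃ ξ < ω_ 2, (v i).val = ξ.toZFSet ∧ (v j).val = π ξ :=
  ⟨Relations.formula₂ (L := aLang) ARel.graph (Term.var i) (Term.var j), fun _ =>
    Formula.realize_rel₂ (L := aLang)⟩

theorem Dfn.thin (i : ℕ) : Dfn fun v : ℕ → AUniv π 𝒴 => ∃ a ∈ 𝒴, (v i).val = ordCode a :=
  ⟨Relations.formula₁ (L := aLang) ARel.thin (Term.var i), fun _ =>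
    Formula.realize_rel₁ (L := aLang)⟩

theorem Dfn.eq (i j : ℕ) : Dfn fun v : ℕ → AUniv π 𝒴 => v i = v j :=
  ⟨Term.equal (Term.var i) (Term.var j), fun v => by simp⟩

theorem Dfn.imp {P Q : (ℕ → AUniv π 𝒴) → Prop} (hP : Dfn P) (hQ : Dfn Q) :
    Dfn fun v => P v → Q v := by
  obtain ⟨φ, hφ⟩ := hP
  obtain ⟨ψ, hψ⟩ := hQ
  exact ⟨φ.imp ψ, fun v => by rw [Formula.realize_imp, hφ, hψ]⟩

theorem Dfn.not {P : (ℕ → AUniv π 𝒴) → Prop} (hP : Dfn P) : Dfn fun v => ¬ P v := by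
  obtain ⟨φ, hφ⟩ := hP
  exact ⟨φ.not, fun v => by rw [Formula.realize_not, hφ]⟩

theorem Dfn.and {P Q : (ℕ → AUniv π 𝒴) → Prop} (hP : Dfn P) (hQ : Dfn Q) :
    Dfn fun v => P v ∧ Q v := by
  convert (hP.imp hQ.not).not using 2
  tauto

theorem Dfn.or {P Q : (ℕ → AUniv π 𝒴) → Prop} (hP : Dfn P) (hQ : Dfn Q) :
    Dfn fun v => P v ∨ Q v := by
  convert hP.not.imp hQ using 2
  tauto

theorem Dfn.iff {P Q : (ℕ → AUniv π 𝒴) → Prop} (hP : Dfn P) (hQ : Dfn Q) :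
    Dfn fun v => (P v ↔ Q v) := by
  convert (hP.imp hQ).and (hQ.imp hP) using 2
  tauto

/-- The bound variable takes index `0` and the free ones shift up by one, as with de Bruijn indices;
nested definitions then unify by computation. -/
theorem Dfn.all {P : AUniv π 𝒴 → (ℕ → AUniv π 𝒴) → Prop}
    (h : Dfn fun v => P (v 0) (fun i => v (i + 1))) : Dfn fun v => ∀ x, P x v := by
  obtain ⟨φ, hφ⟩ := h
  let g : ℕ → ℕ ⊕ Fin 1 := fun n => Nat.casesOn n (Sum.inr 0) Sum.inl
  refine ⟨(BoundedFormula.relabel g φ : aLang.BoundedFormula ℕ 1).all, fun v => ?_⟩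
  refine forall_congr' fun x => ?_
  have h1 := (BoundedFormula.realize_relabel (φ := φ) (g := g) (v := v)
    (xs := (Fin.snoc default x : Fin 1 → AUniv π 𝒴)))
  refine h1.trans ?_
  have h2 := hφ (Sum.elim v ((Fin.snoc default x : Fin 1 → AUniv π 𝒴) ∘ Fin.castAdd 0) ∘ g)
  rw [Formula.Realize] at h2
  convert h2 using 2 <;> rfl

theorem Dfn.ex {P : AUniv π 𝒴 → (ℕ → AUniv π 𝒴) → Prop}
    (h : Dfn fun v => P (v 0) (fun i => v (i + 1))) : Dfn fun v => ∃ x, P x v := by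
  convert (Dfn.all (P := fun x v => ¬ P x v) h.not).not using 2
  simp

/-- Skolem-closed sets contain witnesses for definable predicates with two parameters. -/
theorem IsSkolemClosed.exists_mem (hπ : Set.BijOn π (Set.Iio (ω_ 2)) (H (ℵ_ 2)))
    {S : Set ZFSet.{u}} (hS : IsSkolemClosed π 𝒴 S)
    {P : AUniv π 𝒴 → AUniv π 𝒴 → AUniv π 𝒴 → Prop} (hP : Dfn fun v => P (v 0) (v 1) (v 2))
    {a b : AUniv π 𝒴} (ha : a.val ∈ S) (hb : b.val ∈ S) (h : ∃ y, P y a b) :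
    ∃ y, y.val ∈ S ∧ P y a b := by
  obtain ⟨φ, hφ⟩ := hP
  -- The witness is variable `0` of `P` but must be the last argument of a Skolem formula.
  let g : ℕ → Empty ⊕ Fin 3 := fun n => Sum.inr (match n with
    | 0 => 2
    | 1 => 0
    | _ => 1)
  let ψ : aLang.BoundedFormula Empty (2 + 1) := (BoundedFormula.relabel g φ :
    aLang.BoundedFormula Empty 3)
  have hψ : ∀ y, ψ.Realize default (Fin.snoc ![a, b] y : Fin 3 → AUniv π 𝒴) ↔ P y a b := by
    intro y
    refine (BoundedFormula.realize_relabel (φ := φ) (g := g) (v := default)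
      (xs := (Fin.snoc ![a, b] y : Fin 3 → AUniv π 𝒴))).trans ?_
    have h2 := hφ (Sum.elim default ((Fin.snoc ![a, b] y : Fin 3 → AUniv π 𝒴) ∘ Fin.castAdd 0) ∘ g)
    rw [Formula.Realize] at h2
    convert h2 using 2 <;> rfl
  obtain ⟨y, hy⟩ := h
  let I : Set Ordinal.{u} := {ξ | ξ < ω_ 2 ∧ ∃ y : AUniv π 𝒴, π ξ = y.val ∧ P y a b}
  have hI : I.Nonempty := by
    obtain ⟨ξ, hξ, h⟩ := hπ.surjOn y.2
    exact ⟨ξ, hξ, y, h, hy⟩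
  -- The witness of least index under `π` is exactly the Skolem value.
  obtain ⟨hlt, z, hz, hzP⟩ := csInf_mem hI
  refine ⟨z, hS 2 ψ ![a, b] z ?_ ⟨(hψ z).2 hzP, fun w hw => ?_⟩, hzP⟩
  · intro i
    fin_cases i
    exacts [ha, hb]
  · obtain ⟨ξ, hξ, h⟩ := hπ.surjOn w.2
    exact ⟨sInf I, ξ, csInf_le' ⟨hξ, w, h, (hψ w).1 hw⟩, hξ, hz, h⟩

end Definability

/-! ### Skolem hulls -/

theorem isRegular_aleph_two : (ℵ_ 2 : Cardinal.{u}).IsRegular := by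
  have := Cardinal.isRegular_aleph_add_one 1
  rwa [one_add_one_eq_two] at this

theorem exists_bound {s : Set Ordinal.{u}} (hs : #s ≤ ℵ_ 1) (h : ∀ i ∈ s, i < ω_ 2) :
    ∃ κ < ω_ 2, ∀ i ∈ s, i < κ := by
  refine ⟨sSup ((· + 1) '' s), Ordinal.sSup_add_one_lt_of_lt_cof ?_ h, fun i hi => ?_⟩
  · have h2 : (Ordinal.lift.{u + 1} (ω_ 2 : Ordinal.{u})).cof = ℵ_ 2 := by
      rw [← Ordinal.lift_cof, isRegular_aleph_two.cof_omega_eq, Cardinal.lift_aleph]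
      simp
    rw [h2]
    exact hs.trans_lt (Cardinal.aleph_lt_aleph.2 one_lt_two)
  · refine (lt_add_one i).trans_le (le_csSup ⟨ω_ 2, ?_⟩ (Set.mem_image_of_mem _ hi))
    rintro _ ⟨j, hj, rfl⟩
    exact Order.add_one_le_of_lt (h j hj)

section SkolemHull

variable (π : Ordinal.{u} → ZFSet.{u}) (𝒴 : Set (Set Ordinal.{u}))

/-- The values of the Skolem functions of `𝒜` at arguments in `e`. -/
def skolemValues (e : Finset ZFSet.{u}) : Set ZFSet.{u} :=
  {z | ∃ (n : ℕ) (φ : aLang.BoundedFormula Empty (n + 1)) (x : Fin n → AUniv π 𝒴)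
    (y : AUniv π 𝒴), (∀ i, (x i).val ∈ e) ∧ IsSkolemValue φ x y ∧ y.val = z}

variable {π 𝒴}

theorem AUniv.le_antisymm (hπ : Set.BijOn π (Set.Iio (ω_ 2)) (H (ℵ_ 2))) {x y : AUniv π 𝒴}
    (h : x.le y) (h' : y.le x) : x = y := by
  obtain ⟨ξ, ζ, h1, h2, h3, h4⟩ := h
  obtain ⟨ξ', ζ', h1', h2', h3', h4'⟩ := h'
  have e1 : ξ = ζ' := hπ.injOn (h1.trans_lt h2) h2' (h3.trans h4'.symm)
  have e2 : ξ' = ζ := hπ.injOn (h1'.trans_lt h2') h2 (h3'.trans h4.symm)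
  subst e1 e2
  have : ξ = ξ' := _root_.le_antisymm h1 h1'
  subst this
  exact Subtype.ext (h3.symm.trans h4)

instance : Countable (Σ n, aLang.BoundedFormula Empty n) := by
  have : Countable aLang.Symbols := by
    have h1 : Countable (Σ l, aLang.Functions l) := ⟨fun x => x.2.elim, fun x => x.2.elim⟩
    have h2 : Countable (Σ l, aLang.Relations l) := by
      have : ∀ l, Countable (aLang.Relations l) := fun l =>
        ⟨fun r : ARel l => match r with
          | ARel.mem => 0
          | ARel.graph => 1
          | ARel.thin => 2, fun r s h => by cases r <;> cases s <;> first | rfl | simp at h⟩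
      infer_instance
    exact inferInstanceAs (Countable ((Σ l, aLang.Functions l) ⊕ (Σ l, aLang.Relations l)))
  refine Cardinal.mk_le_aleph0_iff.1 (FirstOrder.Language.BoundedFormula.card_le.trans ?_)
  have : aLang.card ≤ ℵ₀ := Cardinal.mk_le_aleph0_iff.2 this
  simp [this]

theorem countable_skolemValues (hπ : Set.BijOn π (Set.Iio (ω_ 2)) (H (ℵ_ 2)))
    (e : Finset ZFSet.{u}) : (skolemValues π 𝒴 e).Countable := by
  have hc : ∀ n, Countable (aLang.BoundedFormula Empty n) := fun n =>
    (sigma_mk_injective (i := n) : Function.Injective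
      (Sigma.mk n : aLang.BoundedFormula Empty n → _)).countable
  have he : Countable {x : AUniv π 𝒴 // x.val ∈ e} :=
    (Function.Injective.countable (f := fun x : {x : AUniv π 𝒴 // x.val ∈ e} =>
      (⟨x.1.val, x.2⟩ : e)) fun a b h => Subtype.ext (Subtype.ext (Subtype.mk.inj h)))
  have : skolemValues π 𝒴 e ⊆ ⋃ (n : ℕ) (φ : aLang.BoundedFormula Empty (n + 1))
      (x : Fin n → {x : AUniv π 𝒴 // x.val ∈ e}),
      {z | ∃ y : AUniv π 𝒴, IsSkolemValue φ (fun i => (x i).1) y ∧ y.val = z} := by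
    rintro z ⟨n, φ, x, y, hx, hy, rfl⟩
    simp only [Set.mem_iUnion]
    exact ⟨n, φ, fun i => ⟨x i, hx i⟩, y, hy, rfl⟩
  refine Set.Countable.mono this (Set.countable_iUnion fun n => Set.countable_iUnion fun φ =>
    Set.countable_iUnion fun x => Set.Subsingleton.countable ?_)
  rintro _ ⟨y, hy, rfl⟩ _ ⟨z, hz, rfl⟩
  rw [AUniv.le_antisymm hπ (hy.2 z hz.1) (hz.2 y hy.1)]

theorem isSkolemClosed_iff {S : Set ZFSet.{u}} :
    IsSkolemClosed π 𝒴 S ↔ IsClosedUnder (skolemValues π 𝒴) S := by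
  classical
  constructor
  · rintro h e he _ ⟨n, φ, x, y, hx, hy, rfl⟩
    exact h n φ x y (fun i => he (hx i)) hy
  · intro h n φ x y hx hy
    refine h (Finset.univ.image fun i => (x i).val) ?_ ⟨n, φ, x, y, fun i =>
      Finset.mem_image_of_mem _ (Finset.mem_univ i), hy, rfl⟩
    intro z hz
    obtain ⟨i, -, rfl⟩ := Finset.mem_image.1 (Finset.mem_coe.1 hz)
    exact hx i

theorem Sk_eq_hull (a : Set ZFSet.{u}) : Sk π 𝒴 a = hull (skolemValues π 𝒴) a := by
  simp only [Sk, hull, isSkolemClosed_iff]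

theorem subset_Sk (a : Set ZFSet.{u}) : a ⊆ Sk π 𝒴 a := Sk_eq_hull (π := π) (𝒴 := 𝒴) a ▸ subset_hull a

theorem isSkolemClosed_Sk (a : Set ZFSet.{u}) : IsSkolemClosed π 𝒴 (Sk π 𝒴 a) :=
  isSkolemClosed_iff.2 (Sk_eq_hull (π := π) (𝒴 := 𝒴) a ▸ isClosedUnder_hull a)

theorem Sk_subset {a S : Set ZFSet.{u}} (h : a ⊆ S) (hS : IsSkolemClosed π 𝒴 S) : Sk π 𝒴 a ⊆ S :=
  fun _ hx => hx S ⟨h, hS⟩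

theorem Sk_mono {a b : Set ZFSet.{u}} (h : a ⊆ b) : Sk π 𝒴 a ⊆ Sk π 𝒴 b :=
  Sk_subset (h.trans (subset_Sk b)) (isSkolemClosed_Sk b)

theorem SkO_mono {M N : Set Ordinal.{u}} (h : M ⊆ N) : SkO π 𝒴 M ⊆ SkO π 𝒴 N :=
  Sk_mono (Set.image_mono h)

theorem isSkolemClosed_H : IsSkolemClosed π 𝒴 (H (ℵ_ 2)) := fun _ _ _ y _ _ => y.2

theorem SkO_subset_H {M : Set Ordinal.{u}} (hM : M ⊆ Set.Iio (ω_ 2)) : SkO π 𝒴 M ⊆ H (ℵ_ 2) := by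
  refine Sk_subset ?_ isSkolemClosed_H
  rintro _ ⟨α, hα, rfl⟩
  exact toZFSet_mem_H (hM hα)

theorem mem_SkO_of_mem {M : Set Ordinal.{u}} {α : Ordinal.{u}} (h : α ∈ M) :
    α.toZFSet ∈ SkO π 𝒴 M := subset_Sk _ (Set.mem_image_of_mem _ h)

theorem subset_ordTrace_SkO {M : Set Ordinal.{u}} (h : M ⊆ Set.Iio (ω_ 2)) :
    M ⊆ ordTrace (SkO π 𝒴 M) := fun _ hα => ⟨h hα, mem_SkO_of_mem hα⟩


/-- `H(ω₂)` is transitive, so a first-order description of the members seen by `𝒜` determines a set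
uniquely. -/
theorem val_ext {x y : ZFSet.{u}} (hx : x ∈ H.{u} (ℵ_ 2)) (hy : y ∈ H.{u} (ℵ_ 2))
    (h : ∀ w : AUniv π 𝒴, w.val ∈ x ↔ w.val ∈ y) : x = y :=
  ZFSet.ext fun z => ⟨fun hz => (h ⟨z, mem_H_of_mem hx hz⟩).1 hz,
    fun hz => (h ⟨z, mem_H_of_mem hy hz⟩).2 hz⟩

variable (π 𝒴) in
/-- An element of `H(ω₂)` as an element of `𝒜`. -/
def AUniv.of (x : ZFSet.{u}) (h : x ∈ H.{u} (ℵ_ 2)) : AUniv π 𝒴 := ⟨x, h⟩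

@[simp]
theorem AUniv.val_of (x : ZFSet.{u}) (h : x ∈ H.{u} (ℵ_ 2)) : (AUniv.of π 𝒴 x h).val = x := rfl

theorem AUniv.val_inj {x y : AUniv π 𝒴} : x.val = y.val ↔ x = y := Subtype.ext_iff.symm

theorem AUniv.val_mem (x : AUniv π 𝒴) : x.val ∈ H.{u} (ℵ_ 2) := x.2

/-- `z = {x, y}` in `𝒜`. -/
def IsUPair (z x y : AUniv π 𝒴) : Prop := ∀ w : AUniv π 𝒴, w.val ∈ z.val ↔ w = x ∨ w = y

theorem Dfn.isUPair (i j k : ℕ) : Dfn fun v : ℕ → AUniv π 𝒴 => IsUPair (v i) (v j) (v k) :=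
  Dfn.all ((Dfn.mem _ _).iff ((Dfn.eq _ _).or (Dfn.eq _ _)))

/-- `(x, y) ∈ s` in `𝒜`. -/
def PairMem (s x y : AUniv π 𝒴) : Prop := ∃ p a b : AUniv π 𝒴,
  p.val ∈ s.val ∧ IsUPair a x x ∧ IsUPair b x y ∧ IsUPair p a b

theorem Dfn.pairMem (i j k : ℕ) : Dfn fun v : ℕ → AUniv π 𝒴 => PairMem (v i) (v j) (v k) :=
  Dfn.ex (Dfn.ex (Dfn.ex ((Dfn.mem _ _).and ((Dfn.isUPair _ _ _).and
    ((Dfn.isUPair _ _ _).and (Dfn.isUPair _ _ _))))))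

theorem aleph0_lt_aleph_two : ℵ₀ < (ℵ_ 2 : Cardinal.{u}) := by
  rw [← Cardinal.aleph_zero]
  exact Cardinal.aleph_lt_aleph.2 two_pos

theorem ofSet_mem_H_aleph_two {s : Set ZFSet.{u}} (hs : s.Countable) (h : s ⊆ H (ℵ_ 2)) :
    ofSet s ∈ H (ℵ_ 2) :=
  ofSet_mem_H aleph0_lt_aleph_two isRegular_aleph_two hs h

theorem upair_mem_H {x y : ZFSet.{u}} (hx : x ∈ H (ℵ_ 2)) (hy : y ∈ H (ℵ_ 2)) :
    ({x, y} : ZFSet.{u}) ∈ H (ℵ_ 2) := by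
  have h := ofSet_mem_H_aleph_two (s := {x, y}) (Set.toFinite _).countable
    (Set.insert_subset hx (Set.singleton_subset_iff.2 hy))
  have e : ofSet {x, y} = ({x, y} : ZFSet.{u}) := by
    ext z
    rw [mem_ofSet (Set.toFinite _).countable.to_subtype.toSmall]
    simp
  rwa [e] at h

theorem isUPair_iff {z x y : AUniv π 𝒴} : IsUPair z x y ↔ z.val = {x.val, y.val} := by
  constructor
  · intro h
    refine val_ext (π := π) (𝒴 := 𝒴) z.2 (upair_mem_H x.2 y.2) fun w => ?_
    rw [h w, ZFSet.mem_pair, AUniv.val_inj, AUniv.val_inj]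
  · intro h w
    rw [h, ZFSet.mem_pair, AUniv.val_inj, AUniv.val_inj]

theorem pair_mem_H {x y : ZFSet.{u}} (hx : x ∈ H (ℵ_ 2)) (hy : y ∈ H (ℵ_ 2)) :
    ZFSet.pair x y ∈ H (ℵ_ 2) := by
  have : ZFSet.pair x y = {{x, x}, {x, y}} := by
    ext; simp [ZFSet.pair]
  rw [this]
  exact upair_mem_H (upair_mem_H hx hx) (upair_mem_H hx hy)

theorem pairMem_iff {s x y : AUniv π 𝒴} : PairMem s x y ↔ ZFSet.pair x.val y.val ∈ s.val := by
  have e : ZFSet.pair x.val y.val = {{x.val, x.val}, {x.val, y.val}} := by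
    ext; simp [ZFSet.pair]
  constructor
  · rintro ⟨p, a, b, hp, ha, hb, h⟩
    rw [isUPair_iff] at ha hb h
    rw [e, ← ha, ← hb, ← h]
    exact hp
  · intro h
    refine ⟨.of π 𝒴 _ (pair_mem_H x.2 y.2), .of π 𝒴 _ (upair_mem_H x.2 x.2),
      .of π 𝒴 _ (upair_mem_H x.2 y.2), h,
      isUPair_iff.2 rfl, isUPair_iff.2 rfl, isUPair_iff.2 e⟩

theorem ordCode_mem_H {M : Set Ordinal.{u}} (hM : M ⊆ Set.Iio (ω_ 2)) (hc : M.Countable) :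
    ordCode M ∈ H (ℵ_ 2) :=
  ofSet_mem_H_aleph_two (hc.image _) (by
    rintro _ ⟨α, hα, rfl⟩
    exact toZFSet_mem_H (hM hα))

theorem ordCode_Iio (δ : Ordinal.{u}) : ordCode (Set.Iio δ) = δ.toZFSet := by
  ext z
  rw [mem_ordCode subset_rfl, Ordinal.mem_toZFSet_iff]
  rfl

theorem ordCode_inter_eq {M N : Set Ordinal.{u}} {β γ : Ordinal.{u}} (hM : M ⊆ Set.Iio β)
    (hN : N ⊆ Set.Iio γ) : ordCode M ∩ ordCode N = ordCode (M ∩ N) := by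
  ext z
  rw [ZFSet.mem_inter, mem_ordCode hM, mem_ordCode hN,
    mem_ordCode (Set.inter_subset_left.trans hM)]
  constructor
  · rintro ⟨⟨α, hα, rfl⟩, ζ, hζ, h⟩
    obtain rfl := Ordinal.toZFSet_injective h
    exact ⟨_, ⟨hα, hζ⟩, rfl⟩
  · rintro ⟨α, hα, rfl⟩
    exact ⟨⟨α, hα.1, rfl⟩, α, hα.2, rfl⟩

section Closed

variable (hπ : Set.BijOn π (Set.Iio (ω_ 2)) (H (ℵ_ 2))) {S : Set ZFSet.{u}}
  (hS : IsSkolemClosed π 𝒴 S)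

include hπ hS

namespace IsSkolemClosed

/-- Together with `index_mem` this shows that a Skolem-closed set is determined within `H(ω₂)` by
its ordinals. -/
theorem apply_mem {ξ : Ordinal.{u}} (hξ : ξ < ω_ 2) (h : ξ.toZFSet ∈ S) : π ξ ∈ S := by
  obtain ⟨y, hy, ζ, hζ, h1, h2⟩ := hS.exists_mem hπ
    (P := fun y a _ => ∃ ξ < ω_ 2, a.val = ξ.toZFSet ∧ y.val = π ξ) (Dfn.graph 1 0)
    (a := (.of π 𝒴 (ξ.toZFSet) (toZFSet_mem_H hξ))) (b := (.of π 𝒴 (ξ.toZFSet) (toZFSet_mem_H hξ))) h h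
    ⟨(.of π 𝒴 (π ξ) (hπ.mapsTo hξ)), ξ, hξ, rfl, rfl⟩
  obtain rfl : ξ = ζ := Ordinal.toZFSet_injective h1
  rwa [h2] at hy

theorem index_mem {ξ : Ordinal.{u}} (hξ : ξ < ω_ 2) (h : π ξ ∈ S) : ξ.toZFSet ∈ S := by
  obtain ⟨y, hy, ζ, hζ, h1, h2⟩ := hS.exists_mem hπ
    (P := fun y a _ => ∃ ξ < ω_ 2, y.val = ξ.toZFSet ∧ a.val = π ξ) (Dfn.graph 0 1)
    (a := (.of π 𝒴 (π ξ) (hπ.mapsTo hξ))) (b := (.of π 𝒴 (π ξ) (hπ.mapsTo hξ))) h h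
    ⟨(.of π 𝒴 (ξ.toZFSet) (toZFSet_mem_H hξ)), ξ, hξ, rfl, rfl⟩
  obtain rfl : ξ = ζ := hπ.injOn hξ hζ h2
  rwa [h1] at hy

theorem succ_mem {ξ : Ordinal.{u}} (hξ : ξ + 1 < ω_ 2) (h : ξ.toZFSet ∈ S) :
    (ξ + 1).toZFSet ∈ S := by
  have hξ' : ξ < ω_ 2 := (lt_add_one ξ).trans hξ
  have key : ∀ w : AUniv π 𝒴, w.val ∈ (ξ + 1).toZFSet ↔ w.val ∈ ξ.toZFSet ∨
      w = (.of π 𝒴 (ξ.toZFSet) (toZFSet_mem_H hξ')) := fun w => by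
    rw [Ordinal.toZFSet_add_one, ZFSet.mem_insert_iff, or_comm]
    rw [← AUniv.val_inj, AUniv.val_of]
  obtain ⟨y, hy, h1⟩ := hS.exists_mem hπ
    (P := fun y a _ => ∀ w : AUniv π 𝒴, w.val ∈ y.val ↔ w.val ∈ a.val ∨ w = a)
    (Dfn.all ((Dfn.mem _ _).iff ((Dfn.mem _ _).or (Dfn.eq _ _))))
    (a := (.of π 𝒴 (ξ.toZFSet) (toZFSet_mem_H hξ'))) (b := (.of π 𝒴 (ξ.toZFSet) (toZFSet_mem_H hξ'))) h h
    ⟨(.of π 𝒴 ((ξ + 1).toZFSet) (toZFSet_mem_H hξ)), key⟩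
  rwa [val_ext (π := π) (𝒴 := 𝒴) y.val_mem (toZFSet_mem_H hξ) fun w => (h1 w).trans (key w).symm] at hy

theorem inter_mem {x y : ZFSet.{u}} (hxH : x ∈ H (ℵ_ 2)) (hyH : y ∈ H (ℵ_ 2)) (hx : x ∈ S)
    (hy : y ∈ S) : x ∩ y ∈ S := by
  have hH : x ∩ y ∈ H (ℵ_ 2) := mem_H_of_subset hxH fun _ h => (ZFSet.mem_inter.1 h).1
  obtain ⟨z, hz, h1⟩ := hS.exists_mem hπ
    (P := fun z x y => ∀ w : AUniv π 𝒴, w.val ∈ z.val ↔ w.val ∈ x.val ∧ w.val ∈ y.val)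
    (Dfn.all ((Dfn.mem _ _).iff ((Dfn.mem _ _).and (Dfn.mem _ _))))
    (a := (.of π 𝒴 (x) (hxH))) (b := (.of π 𝒴 (y) (hyH))) hx hy ⟨(.of π 𝒴 (x ∩ y) (hH)), fun w => ZFSet.mem_inter⟩
  rwa [val_ext (π := π) (𝒴 := 𝒴) z.val_mem hH fun w => (h1 w).trans ZFSet.mem_inter.symm] at hz

/-- The elements of a countable element of `S` enumerated without repetition lie in `S`. -/
theorem subset_of_enum {x : ZFSet.{u}} (hxH : x ∈ H (ℵ_ 2)) (hx : x ∈ S) (e : ℕ → ZFSet.{u})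
    (he : Function.Injective e) (hex : ∀ z, z ∈ x ↔ z ∈ Set.range e) : ∀ z ∈ x, z ∈ S := by
  have heH : ∀ n, e n ∈ H (ℵ_ 2) := fun n => mem_H_of_mem hxH ((hex _).2 ⟨n, rfl⟩)
  let σ : Set ZFSet.{u} := Set.range fun n => ZFSet.pair (e n) (e (n + 1))
  have hσ : σ.Countable := Set.countable_range _
  have hσH : ofSet σ ∈ H (ℵ_ 2) := ofSet_mem_H_aleph_two hσ (by
    rintro _ ⟨n, rfl⟩
    exact pair_mem_H (heH _) (heH _))
  have hmσ : ∀ z, z ∈ ofSet σ ↔ z ∈ σ := fun z => mem_ofSet hσ.to_subtype.toSmall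
  -- An enumeration expressed without mentioning `ω`: `s` is a single-valued successor relation with
  -- values in `x`, and induction from `y` along `s` reaches all of `x`.
  let Q : AUniv π 𝒴 → AUniv π 𝒴 → AUniv π 𝒴 → Prop := fun y s x => y.val ∈ x.val ∧
    (∀ t : AUniv π 𝒴, y.val ∈ t.val → (∀ a b : AUniv π 𝒴, a.val ∈ t.val → PairMem s a b →
      b.val ∈ t.val) → ∀ a : AUniv π 𝒴, a.val ∈ x.val → a.val ∈ t.val) ∧
    (∀ a b : AUniv π 𝒴, PairMem s a b → b.val ∈ x.val) ∧
    ∀ a b c : AUniv π 𝒴, PairMem s a b → PairMem s a c → b = c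
  have hQ : ∀ i j k, Dfn fun v : ℕ → AUniv π 𝒴 => Q (v i) (v j) (v k) := fun i j k =>
    (Dfn.mem _ _).and (Dfn.and (Dfn.all ((Dfn.mem _ _).imp (Dfn.imp (Dfn.all (Dfn.all
      ((Dfn.mem _ _).imp ((Dfn.pairMem _ _ _).imp (Dfn.mem _ _)))))
      (Dfn.all ((Dfn.mem _ _).imp (Dfn.mem _ _)))))) (Dfn.and (Dfn.all (Dfn.all
      ((Dfn.pairMem _ _ _).imp (Dfn.mem _ _)))) (Dfn.all (Dfn.all (Dfn.all
      ((Dfn.pairMem _ _ _).imp ((Dfn.pairMem _ _ _).imp (Dfn.eq _ _))))))))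
  have hpm : ∀ a b : AUniv π 𝒴, PairMem (.of π 𝒴 (ofSet σ) (hσH)) a b ↔ ∃ n, a.val = e n ∧ b.val = e (n + 1) := by
    intro a b
    rw [pairMem_iff]
    refine (hmσ _).trans (exists_congr fun n => ?_)
    rw [eq_comm, ZFSet.pair_inj]
  have hQ0 : Q (.of π 𝒴 (e 0) (heH 0)) (.of π 𝒴 (ofSet σ) (hσH)) (.of π 𝒴 (x) (hxH)) := by
    refine ⟨(hex _).2 ⟨0, rfl⟩, fun t h0 hstep a ha => ?_, fun a b hab => ?_,
      fun a b c hab hac => ?_⟩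
    · obtain ⟨n, hn⟩ := (hex _).1 ha
      have : ∀ n, e n ∈ t.val := by
        intro n
        induction n with
        | zero => exact h0
        | succ n ih => exact hstep (.of π 𝒴 (e n) (heH n)) (.of π 𝒴 (e (n + 1)) (heH _)) ih ((hpm _ _).2 ⟨n, rfl, rfl⟩)
      rw [← hn]
      exact this n
    · obtain ⟨n, -, h2⟩ := (hpm _ _).1 hab
      exact (hex _).2 ⟨n + 1, h2.symm⟩
    · obtain ⟨n, h1, h2⟩ := (hpm _ _).1 hab
      obtain ⟨m, h3, h4⟩ := (hpm _ _).1 hac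
      obtain rfl := he (h1.symm.trans h3)
      exact AUniv.val_inj.1 (h2.trans h4.symm)
  obtain ⟨s, hs, y, hQs⟩ := hS.exists_mem hπ (P := fun s x _ => ∃ y, Q y s x)
    (Dfn.ex (hQ _ _ _)) (a := (.of π 𝒴 (x) (hxH))) (b := (.of π 𝒴 (x) (hxH))) hx hx ⟨_, _, hQ0⟩
  obtain ⟨y, hy, hyx, hind, hsub, hfun⟩ := hS.exists_mem hπ (P := Q) (hQ _ _ _) (a := s) (b := (.of π 𝒴 (x) (hxH)))
    hs hx ⟨y, hQs⟩
  -- `S` need not be definable, but `x ∩ S` belongs to `H(ω₂)` as a subset of `x`, so the induction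
  -- clause applies to it.
  let t : ZFSet.{u} := ZFSet.sep (· ∈ S) x
  have ht : t ∈ H (ℵ_ 2) := mem_H_of_subset hxH fun _ h => (ZFSet.mem_sep.1 h).1
  have key := hind (.of π 𝒴 t ht) (ZFSet.mem_sep.2 ⟨hyx, hy⟩) fun a b ha hab => by
    obtain ⟨c, hc, hac⟩ := hS.exists_mem hπ (P := fun c s a => PairMem s a c)
      (Dfn.pairMem _ _ _) (a := s) (b := a) hs (ZFSet.mem_sep.1 ha).2 ⟨b, hab⟩
    rw [hfun a b c hab hac]
    exact ZFSet.mem_sep.2 ⟨hsub a c hac, hc⟩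
  intro z hz
  exact (ZFSet.mem_sep.1 (key (.of π 𝒴 z (mem_H_of_mem hxH hz)) hz)).2

/-- The traces on `δ` of the members of `𝒴` have indices bounded by an ordinal in `S`. -/
theorem exists_index_bound (h𝒴 : ∀ a ∈ 𝒴, a ⊆ Set.Iio (ω_ 2) ∧ a.Countable) {δ : Ordinal.{u}}
    (hthin : Cardinal.mk ((fun a => a ∩ Set.Iio δ) '' 𝒴) ≤ ℵ_ 1) (hδ : δ < ω_ 2)
    (h : δ.toZFSet ∈ S) : ∃ κ < ω_ 2, κ.toZFSet ∈ S ∧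
      ∀ a ∈ 𝒴, ∃ ξ < κ, π ξ = ordCode (a ∩ Set.Iio δ) := by
  have hcode : ∀ a ∈ 𝒴, ordCode (a ∩ Set.Iio δ) ∈ H (ℵ_ 2) := fun a ha =>
    ordCode_mem_H (Set.inter_subset_left.trans (h𝒴 a ha).1)
      ((h𝒴 a ha).2.mono Set.inter_subset_left)
  have hδc := ordCode_Iio δ
  obtain ⟨κ, hκ, hb⟩ : ∃ κ < ω_ 2, ∀ ξ ∈ {ξ | ξ < ω_ 2 ∧ ∃ a ∈ 𝒴, π ξ = ordCode (a ∩ Set.Iio δ)},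
      ξ < κ := by
    refine exists_bound (le_trans ?_ hthin) fun i hi => hi.1
    choose! g hg using fun a (ha : a ∈ (fun a => a ∩ Set.Iio δ) '' 𝒴) =>
      (show ∃ ξ < ω_ 2, π ξ = ordCode a by
        obtain ⟨b, hb, rfl⟩ := ha
        exact hπ.surjOn (hcode b hb))
    refine (Cardinal.mk_le_mk_of_subset ?_).trans (Cardinal.mk_image_le (f := g))
    rintro ξ ⟨hξ, a, ha, h⟩
    have ha' : a ∩ Set.Iio δ ∈ (fun a => a ∩ Set.Iio δ) '' 𝒴 := ⟨a, ha, rfl⟩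
    exact ⟨a ∩ Set.Iio δ, ha', hπ.injOn (hg _ ha').1 hξ ((hg _ ha').2.trans h.symm)⟩
  -- The first conjunct says that `y` is an ordinal below `ω₂`, the second that the indices of all
  -- traces on `δ` are members of `y`. The bound `κ` only shows that a solution exists; the one
  -- found in `S` may be another.
  obtain ⟨y, hy, ⟨x, κ', hκ', hyκ, -⟩, h2⟩ := hS.exists_mem hπ
    (P := fun y d _ => (∃ x : AUniv π 𝒴, ∃ ξ < ω_ 2, y.val = ξ.toZFSet ∧ x.val = π ξ) ∧
      ∀ a : AUniv π 𝒴, (∃ b ∈ 𝒴, a.val = ordCode b) → ∀ z : AUniv π 𝒴,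
        (∀ w : AUniv π 𝒴, w.val ∈ z.val ↔ w.val ∈ a.val ∧ w.val ∈ d.val) →
        ∃ u : AUniv π 𝒴, u.val ∈ y.val ∧ ∃ ξ < ω_ 2, u.val = ξ.toZFSet ∧ z.val = π ξ)
    (Dfn.and (Dfn.ex (Dfn.graph _ _)) (Dfn.all ((Dfn.thin _).imp (Dfn.all (Dfn.imp
      (Dfn.all ((Dfn.mem _ _).iff ((Dfn.mem _ _).and (Dfn.mem _ _))))
      (Dfn.ex ((Dfn.mem _ _).and (Dfn.graph _ _))))))))
    (a := .of π 𝒴 _ (toZFSet_mem_H hδ)) (b := .of π 𝒴 _ (toZFSet_mem_H hδ)) h h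
    ⟨.of π 𝒴 _ (toZFSet_mem_H hκ), ⟨.of π 𝒴 (π κ) (hπ.mapsTo hκ), κ, hκ, rfl, rfl⟩, by
      rintro a ⟨b, hb', hab⟩ z hz
      obtain ⟨ξ, hξ, hξz⟩ := hπ.surjOn z.val_mem
      have hzb : z.val = ordCode (b ∩ Set.Iio δ) := by
        refine val_ext (π := π) (𝒴 := 𝒴) z.val_mem (hcode b hb') fun w => ?_
        rw [hz w, hab, AUniv.val_of, ← hδc, ← ZFSet.mem_inter,
          ordCode_inter_eq (h𝒴 b hb').1 subset_rfl]
      have hξκ : ξ < κ := hb ξ ⟨hξ, b, hb', hξz.trans hzb⟩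
      exact ⟨.of π 𝒴 _ (toZFSet_mem_H hξ), Ordinal.toZFSet_mem_toZFSet_iff.2 hξκ, ξ, hξ, rfl,
        hξz.symm⟩⟩
  refine ⟨κ', hκ', hyκ ▸ hy, fun a ha => ?_⟩
  have haH : ordCode a ∈ H (ℵ_ 2) := ordCode_mem_H (h𝒴 a ha).1 (h𝒴 a ha).2
  obtain ⟨u, hu, ξ, hξ, h3, h4⟩ := h2 (.of π 𝒴 _ haH) ⟨a, ha, rfl⟩ (.of π 𝒴 _ (hcode a ha))
    fun w => by
      rw [AUniv.val_of, AUniv.val_of, AUniv.val_of, ← hδc, ← ZFSet.mem_inter,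
        ordCode_inter_eq (h𝒴 a ha).1 subset_rfl]
  rw [h3, hyκ, Ordinal.toZFSet_mem_toZFSet_iff] at hu
  exact ⟨ξ, hu, h4.symm⟩

theorem mem_of_mem_code {L : Set Ordinal.{u}} (hL : L ⊆ Set.Iio (ω_ 2)) (hc : L.Countable)
    (hi : L.Infinite) (h : ordCode L ∈ S) {α : Ordinal.{u}} (hα : α ∈ L) : α.toZFSet ∈ S := by
  have := hc.to_subtype
  have := hi.to_subtype
  obtain ⟨e⟩ := nonempty_equiv_of_countable (α := ℕ) (β := L)
  refine hS.subset_of_enum hπ (ordCode_mem_H hL hc) h (fun n => (e n : Ordinal).toZFSet) ?_ ?_ _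
    ((toZFSet_mem_ordCode hL).2 hα)
  · intro m n h
    exact e.injective (Subtype.ext (Ordinal.toZFSet_injective h))
  · intro z
    rw [mem_ordCode hL]
    constructor
    · rintro ⟨β, hβ, rfl⟩
      exact ⟨e.symm ⟨β, hβ⟩, by simp⟩
    · rintro ⟨n, rfl⟩
      exact ⟨e n, (e n).2, rfl⟩

/-- The cut point `η` need not be in `S`. It can be replaced by the least element of `L` from `η`
on, which is in `S` because `L` is countable; if there is none, the cut is `L`. -/
theorem cut_mem {L : Set Ordinal.{u}} (hL : L ⊆ Set.Iio (ω_ 2)) (hc : L.Countable)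
    (hi : L.Infinite) (h : ordCode L ∈ S) (η : Ordinal.{u}) : ordCode (L ∩ Set.Iio η) ∈ S := by
  by_cases hne : {τ | τ ∈ L ∧ η ≤ τ}.Nonempty
  · obtain ⟨hτL, hτ⟩ := csInf_mem hne
    set τ := sInf {τ | τ ∈ L ∧ η ≤ τ} with hτdef
    have : L ∩ Set.Iio η = L ∩ Set.Iio τ := by
      ext α
      refine and_congr_right fun hα => ⟨fun h => lt_of_lt_of_le h hτ, fun h => ?_⟩
      by_contra h'
      exact (csInf_le' (show α ∈ {τ | τ ∈ L ∧ η ≤ τ} from ⟨hα, not_lt.1 h'⟩)).not_gt h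
    rw [this, ← ordCode_inter_eq hL subset_rfl, ordCode_Iio]
    exact hS.inter_mem hπ (ordCode_mem_H hL hc) (toZFSet_mem_H (hL hτL)) h
      (hS.mem_of_mem_code hπ hL hc hi h hτL)
  · have : L ∩ Set.Iio η = L := Set.inter_eq_left.2 fun α hα =>
      not_le.1 fun h' => hne ⟨α, hα, h'⟩
    rwa [this]


end IsSkolemClosed
end Closed

/-- The index of `x` under `π` belongs to both hulls, hence to both traces. -/
theorem mem_SkO_inter (hπ : Set.BijOn π (Set.Iio (ω_ 2)) (H (ℵ_ 2))) {M N : Set Ordinal.{u}}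
    (hM : ordTrace (SkO π 𝒴 M) ⊆ M) (hN : ordTrace (SkO π 𝒴 N) ⊆ N) {x : ZFSet.{u}}
    (hx : x ∈ H (ℵ_ 2)) (h : x ∈ SkO π 𝒴 M) (h' : x ∈ SkO π 𝒴 N) : x ∈ SkO π 𝒴 (M ∩ N) := by
  obtain ⟨ξ, hξ, rfl⟩ := hπ.surjOn hx
  refine (isSkolemClosed_Sk _).apply_mem hπ hξ (mem_SkO_of_mem ⟨hM ⟨hξ, ?_⟩, hN ⟨hξ, ?_⟩⟩)
  · exact (isSkolemClosed_Sk _).index_mem hπ hξ h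
  · exact (isSkolemClosed_Sk _).index_mem hπ hξ h'

end SkolemHull


/-! ### The club `C` and the set `Λ` -/

/-- The standing assumptions on `π` and `𝒴`. -/
structure Setting (π : Ordinal.{u} → ZFSet.{u}) (𝒴 : Set (Set Ordinal.{u})) : Prop where
  bijOn : Set.BijOn π (Set.Iio (ω_ 2)) (H (ℵ_ 2))
  stationary : IsStationaryIn (Set.Iio (ω_ 2)) 𝒴
  thin : ∀ β < ω_ 2, Cardinal.mk ((fun a => a ∩ Set.Iio β) '' 𝒴) ≤ ℵ_ 1
  initial : ∀ a ∈ 𝒴, ∀ β < ω_ 2, a ∩ Set.Iio β ∈ 𝒴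

theorem add_one_lt_omega_two {α : Ordinal.{u}} (h : α < ω_ 2) : α + 1 < ω_ 2 :=
  (Cardinal.isSuccLimit_omega 2).add_one_lt h

theorem lt_aleph_two_iff {c : Cardinal.{u}} : c < ℵ_ 2 ↔ c ≤ ℵ_ 1 := by
  rw [← one_add_one_eq_two, ← Cardinal.succ_aleph, Order.lt_succ_iff]

theorem card_le_of_lt_omega_two {α : Ordinal.{u}} (h : α < ω_ 2) : α.card ≤ ℵ_ 1 := by
  rwa [← lt_aleph_two_iff, ← Cardinal.lt_ord, Cardinal.ord_aleph]

theorem mk_Iio_le_of_lt_omega_two {α : Ordinal.{u}} (h : α < ω_ 2) :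
    #(Set.Iio α) ≤ ℵ_ 1 := by
  rw [Cardinal.mk_Iio_ordinal]
  simpa using Cardinal.lift_le.{u + 1}.2 (card_le_of_lt_omega_two h)

section Club

variable {π : Ordinal.{u} → ZFSet.{u}} {𝒴 : Set (Set Ordinal.{u})}

theorem ordTrace_mono {S T : Set ZFSet.{u}} (h : S ⊆ T) : ordTrace S ⊆ ordTrace T :=
  fun _ hα => ⟨hα.1, h hα.2⟩

theorem ordTrace_subset_Iio (S : Set ZFSet.{u}) : ordTrace S ⊆ Set.Iio (ω_ 2) := fun _ h => h.1

/-- Hulls of initial segments form a chain, so their union is Skolem-closed. This gives closedness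
of `C`. -/
theorem ordTrace_SkO_iUnion {ι : Type*} [Nonempty ι] (s : ι → Ordinal.{u}) {β : Ordinal.{u}}
    (hβ : Set.Iio β ⊆ ⋃ i, Set.Iio (s i))
    (hs : ∀ i, ordTrace (SkO π 𝒴 (Set.Iio (s i))) ⊆ Set.Iio β) :
    ordTrace (SkO π 𝒴 (Set.Iio β)) ⊆ Set.Iio β := by
  have hsub : SkO π 𝒴 (Set.Iio β) ⊆ ⋃ i, SkO π 𝒴 (Set.Iio (s i)) := by
    refine Sk_subset ?_ (isSkolemClosed_iff.2 (isClosedUnder_iUnion ?_ fun i =>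
      isSkolemClosed_iff.1 (isSkolemClosed_Sk _)))
    · rintro _ ⟨α, hα, rfl⟩
      obtain ⟨i, hi⟩ := Set.mem_iUnion.1 (hβ hα)
      exact Set.mem_iUnion.2 ⟨i, mem_SkO_of_mem hi⟩
    · intro i j
      rcases le_total (s i) (s j) with h | h
      · exact ⟨j, SkO_mono (Set.Iio_subset_Iio h), subset_rfl⟩
      · exact ⟨i, subset_rfl, SkO_mono (Set.Iio_subset_Iio h)⟩
  rintro α ⟨h1, h2⟩
  obtain ⟨i, hi⟩ := Set.mem_iUnion.1 (hsub h2)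
  exact hs i ⟨h1, hi⟩

theorem mem_clubC_iff {β : Ordinal.{u}} (hβ : β < ω_ 2) :
    β ∈ clubC π 𝒴 ↔ ordTrace (SkO π 𝒴 (Set.Iio β)) ⊆ Set.Iio β :=
  ⟨fun h => h.2.subset, fun h =>
    ⟨hβ, h.antisymm (subset_ordTrace_SkO (Set.Iio_subset_Iio hβ.le))⟩⟩

theorem Lam_subset_clubC : Lam π 𝒴 ⊆ clubC π 𝒴 := by
  rintro β ⟨hβ, hcof, hlim⟩
  rw [mem_clubC_iff hβ]
  have hne : Nonempty {δ | δ ∈ clubC π 𝒴 ∧ δ < β} := by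
    have : β ≠ 0 := by
      rintro rfl
      simp at hcof
      exact absurd hcof.symm (Cardinal.aleph_pos 1).ne'
    obtain ⟨δ, hδ, -, h⟩ := hlim 0 (pos_iff_ne_zero.2 this)
    exact ⟨δ, hδ, h⟩
  refine ordTrace_SkO_iUnion (fun δ : {δ | δ ∈ clubC π 𝒴 ∧ δ < β} => (δ : Ordinal)) ?_ ?_
  · intro γ hγ
    obtain ⟨δ, hδ, h1, h2⟩ := hlim γ hγ
    exact Set.mem_iUnion.2 ⟨⟨δ, hδ, h2⟩, h1⟩
  · rintro ⟨δ, hδ, h⟩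
    rw [hδ.2]
    exact Set.Iio_subset_Iio h.le

variable (π 𝒴) in
/-- A strict upper bound of `Sk(α) ∩ ω₂`. -/
noncomputable def traceBound (α : Ordinal.{u}) : Ordinal.{u} :=
  max (α + 1) (sSup ((· + 1) '' ordTrace (SkO π 𝒴 (Set.Iio α))))

theorem bddAbove_succ_ordTrace (S : Set ZFSet.{u}) : BddAbove ((· + 1) '' ordTrace S) :=
  ⟨ω_ 2, by
    rintro _ ⟨α, hα, rfl⟩
    exact Order.add_one_le_of_lt hα.1⟩

theorem ordTrace_subset_traceBound (α : Ordinal.{u}) :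
    ordTrace (SkO π 𝒴 (Set.Iio α)) ⊆ Set.Iio (traceBound π 𝒴 α) := fun ξ hξ =>
  (lt_add_one ξ).trans_le (le_max_of_le_right
    (le_csSup (bddAbove_succ_ordTrace _) (Set.mem_image_of_mem _ hξ)))

theorem traceBound_lt (hπ : Set.BijOn π (Set.Iio (ω_ 2)) (H (ℵ_ 2))) {α : Ordinal.{u}}
    (hα : α < ω_ 2) : traceBound π 𝒴 α < ω_ 2 := by
  refine max_lt (add_one_lt_omega_two hα) ?_
  have hcard : #(ordTrace (SkO π 𝒴 (Set.Iio α))) ≤ ℵ_ 1 := by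
    have h1 : #(SkO π 𝒴 (Set.Iio α)) ≤ ℵ_ 1 := by
      rw [SkO, Sk_eq_hull]
      exact mk_hull_le (Cardinal.aleph0_le_aleph 1) (countable_skolemValues hπ)
        (Cardinal.mk_image_le.trans (mk_Iio_le_of_lt_omega_two hα))
    refine le_trans ?_ h1
    exact Cardinal.mk_le_of_injective (f := fun ξ : ordTrace (SkO π 𝒴 (Set.Iio α)) =>
      (⟨ξ.1.toZFSet, ξ.2.2⟩ : SkO π 𝒴 (Set.Iio α))) fun a b h =>
        Subtype.ext (Ordinal.toZFSet_injective (Subtype.mk.inj h))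
  obtain ⟨κ, hκ, h⟩ := exists_bound hcard fun i hi => hi.1
  refine lt_of_le_of_lt (csSup_le' ?_) hκ
  rintro _ ⟨ξ, hξ, rfl⟩
  exact Order.add_one_le_of_lt (h ξ hξ)

theorem nfp_mem_clubC (hπ : Set.BijOn π (Set.Iio (ω_ 2)) (H (ℵ_ 2))) {α : Ordinal.{u}}
    (hα : α < ω_ 2) : Ordinal.nfp (traceBound π 𝒴) α ∈ clubC π 𝒴 := by
  have hlt : Ordinal.nfp (traceBound π 𝒴) α < ω_ 2 := by
    refine Ordinal.nfp_lt_ord ?_ (fun i hi => traceBound_lt hπ hi) hα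
    rw [isRegular_aleph_two.cof_omega_eq]
    exact aleph0_lt_aleph_two
  rw [mem_clubC_iff hlt]
  refine ordTrace_SkO_iUnion (fun n : ℕ => (traceBound π 𝒴)^[n] α) ?_ ?_
  · intro γ hγ
    exact Set.mem_iUnion.2 (Ordinal.lt_nfp_iff.1 hγ)
  · intro n
    refine (ordTrace_subset_traceBound _).trans (Set.Iio_subset_Iio ?_)
    rw [← Function.iterate_succ_apply' (traceBound π 𝒴)]
    exact Ordinal.iterate_le_nfp _ _ _

/-- The derivative of `traceBound` is normal and takes values in `C` at successors below `ω₂`. Its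
value at `γ + ω₁` is therefore a limit of `C` of cofinality `ω₁`. -/
theorem exists_Lam_gt (hπ : Set.BijOn π (Set.Iio (ω_ 2)) (H (ℵ_ 2))) {γ : Ordinal.{u}}
    (hγ : γ < ω_ 2) : ∃ β ∈ Lam π 𝒴, γ < β := by
  have hn := Ordinal.isNormal_deriv (traceBound π 𝒴)
  have hlim : Order.IsSuccLimit (γ + ω_ 1) :=
    Ordinal.isSuccLimit_add γ (Cardinal.isSuccLimit_omega 1)
  have hlt : ∀ o < ω_ 2, Ordinal.deriv (traceBound π 𝒴) o < ω_ 2 := by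
    intro o ho
    rw [← Cardinal.ord_aleph] at ho ⊢
    refine Cardinal.deriv_lt_ord isRegular_aleph_two aleph0_lt_aleph_two.ne' (fun i hi => ?_) ho
    rw [Cardinal.ord_aleph] at hi ⊢
    exact traceBound_lt hπ hi
  have hγ1 : γ + ω_ 1 < ω_ 2 :=
    Ordinal.isPrincipal_add_omega 2 hγ (Ordinal.omega_lt_omega.2 one_lt_two)
  refine ⟨Ordinal.deriv (traceBound π 𝒴) (γ + ω_ 1), ⟨hlt _ hγ1, ?_, fun δ hδ => ?_⟩, ?_⟩
  · rw [Ordinal.cof_map_of_isNormal hn hlim, Ordinal.cof_add _ (Ordinal.omega_pos 1).ne',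
      Cardinal.cof_omega_one]
  · obtain ⟨o, ho, h⟩ := (hn.lt_iff_exists_lt hlim).1 hδ
    refine ⟨Ordinal.deriv (traceBound π 𝒴) (o + 1), ?_, h.trans (hn.strictMono (lt_add_one o)),
      hn.strictMono (hlim.add_one_lt ho)⟩
    rw [Ordinal.deriv_add_one]
    exact nfp_mem_clubC hπ (add_one_lt_omega_two (hlt o (ho.trans hγ1)))
  · exact (lt_add_of_pos_right γ (Ordinal.omega_pos 1)).trans_le hn.strictMono.le_apply

end Club

/-! ### Comparison points -/

section Comparison

variable {π : Ordinal.{u} → ZFSet.{u}} {𝒴 : Set (Set Ordinal.{u})}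

theorem sSup_inter_Iio_le (M : Set Ordinal.{u}) (β : Ordinal.{u}) : sSup (M ∩ Set.Iio β) ≤ β :=
  csSup_le' fun _ h => h.2.le

theorem bddAbove_inter_Iio (M : Set Ordinal.{u}) (β : Ordinal.{u}) : BddAbove (M ∩ Set.Iio β) :=
  ⟨β, fun _ h => h.2.le⟩

theorem sSup_inter_Iio_mono {M N : Set Ordinal.{u}} (h : M ⊆ N) {β γ : Ordinal.{u}} (hβ : β ≤ γ) :
    sSup (M ∩ Set.Iio β) ≤ sSup (N ∩ Set.Iio γ) :=
  csSup_le_csSup' (bddAbove_inter_Iio _ _) (Set.inter_subset_inter h (Set.Iio_subset_Iio hβ))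

theorem gammaSet_mono {Γ M N : Set Ordinal.{u}} (h : M ⊆ N) : gammaSet Γ M ⊆ gammaSet Γ N :=
  fun β hβ => ⟨⟨hβ.1.1, sSup_inter_Iio_le N β⟩, fun _ hγ =>
    hβ.2 ⟨hγ.1, (sSup_inter_Iio_mono h le_rfl).trans hγ.2⟩⟩

/-- `β` itself competes for the minimum, so the cut set has no points beyond it; up to `β` cutting
changes nothing. -/
theorem mem_gammaSet_inter_iff {Γ M : Set Ordinal.{u}} {β η : Ordinal.{u}} (hβ : β ∈ Γ) :
    η ∈ gammaSet Γ (M ∩ Set.Iio β) ↔ η ∈ gammaSet Γ M ∧ η ≤ β := by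
  have key : η ≤ β → M ∩ Set.Iio β ∩ Set.Iio η = M ∩ Set.Iio η := fun h => by
    rw [Set.inter_assoc, Set.inter_eq_right.2 (Set.Iio_subset_Iio h)]
  constructor
  · intro h
    have hle : η ≤ β := h.2 ⟨hβ, csSup_le' fun _ h => h.1.2.le⟩
    refine ⟨?_, hle⟩
    rwa [gammaSet, Set.mem_ofPred_eq, key hle] at h
  · rintro ⟨h, hle⟩
    rwa [gammaSet, Set.mem_ofPred_eq, key hle]

theorem cmp_comm (Γ M N : Set Ordinal.{u}) : cmp Γ M N = cmp Γ N M := by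
  rw [cmp, cmp, Set.inter_comm]

theorem lt_omega_two_of_mem_Lam {β : Ordinal.{u}} (h : β ∈ Lam π 𝒴) : β < ω_ 2 := h.1

theorem bddAbove_gammaSet (M : Set Ordinal.{u}) (s : Set Ordinal.{u}) :
    BddAbove (gammaSet (Lam π 𝒴) M ∩ s) :=
  ⟨ω_ 2, fun _ h => (lt_omega_two_of_mem_Lam h.1.1.1).le⟩

theorem le_cmp {M N : Set Ordinal.{u}} {β : Ordinal.{u}} (hM : β ∈ gammaSet (Lam π 𝒴) M)
    (hN : β ∈ gammaSet (Lam π 𝒴) N) : β ≤ cmp (Lam π 𝒴) M N :=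
  le_csSup (bddAbove_gammaSet _ _) ⟨hM, hN⟩

theorem mem_gammaSet_of_isLeast {Γ M : Set Ordinal.{u}} {δ β : Ordinal.{u}}
    (hβ : IsLeast {γ | γ ∈ Γ ∧ δ ≤ γ} β) (h : δ ≤ sSup (M ∩ Set.Iio β)) : β ∈ gammaSet Γ M :=
  ⟨⟨hβ.1.1, sSup_inter_Iio_le M β⟩, fun _ hγ => hβ.2 ⟨hγ.1, h.trans hγ.2⟩⟩

variable (hπ : Set.BijOn π (Set.Iio (ω_ 2)) (H (ℵ_ 2)))

include hπ

theorem exists_isLeast_Lam {δ : Ordinal.{u}} (hδ : δ < ω_ 2) :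
    ∃ β, IsLeast {γ | γ ∈ Lam π 𝒴 ∧ δ ≤ γ} β := by
  obtain ⟨γ, hγ, h⟩ := exists_Lam_gt (𝒴 := 𝒴) hπ hδ
  exact ⟨_, isLeast_csInf (⟨γ, hγ, h.le⟩ : {γ | γ ∈ Lam π 𝒴 ∧ δ ≤ γ}.Nonempty)⟩

/-- If the supremum were not attained it would be a limit of both `M` and `N`, or `0`. The first
point of `Λ` from it on would then lie in both sets, so it would equal the supremum. -/
theorem cmp_mem {M N : Set Ordinal.{u}} (hM : M ⊆ Set.Iio (ω_ 2)) (hc : M.Countable) :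
    cmp (Lam π 𝒴) M N ∈ gammaSet (Lam π 𝒴) M ∩ gammaSet (Lam π 𝒴) N := by
  set S := gammaSet (Lam π 𝒴) M ∩ gammaSet (Lam π 𝒴) N with hS
  by_contra hδS
  have hbdd : BddAbove S := bddAbove_gammaSet _ _
  have hlim : ∀ γ < sSup S, ∃ β ∈ S, γ < β ∧ β < sSup S := by
    intro γ hγ
    obtain ⟨β, hβ, h⟩ := exists_lt_of_lt_csSup' hγ
    exact ⟨β, hβ, h, lt_of_le_of_ne (le_csSup hbdd hβ) fun e => hδS (by rw [cmp, ← hS, ← e]; exact hβ)⟩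
  have hsup : ∀ K, S ⊆ gammaSet (Lam π 𝒴) K → ∀ γ < sSup S, ∃ m ∈ K, γ < m ∧ m < sSup S := by
    intro K hK γ hγ
    obtain ⟨β₁, hβ₁, h1, h1'⟩ := hlim γ hγ
    obtain ⟨β₂, hβ₂, h2, h2'⟩ := hlim β₁ h1'
    have : β₁ < sSup (K ∩ Set.Iio β₂) := by
      by_contra h
      exact ((hK hβ₂).2 ⟨hβ₁.1.1.1, not_lt.1 h⟩).not_gt h2
    obtain ⟨m, hm, h3⟩ := exists_lt_of_lt_csSup' this
    exact ⟨m, hm.1, h1.trans h3, hm.2.trans h2'⟩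
  have hlt : sSup S < ω_ 2 := by
    obtain ⟨κ, hκ, h⟩ := exists_bound ((Cardinal.mk_le_aleph0_iff.2 hc.to_subtype).trans
      (Cardinal.aleph0_le_aleph 1)) hM
    refine lt_of_le_of_lt (le_of_forall_lt fun γ hγ => ?_) hκ
    obtain ⟨m, hm, h1, -⟩ := hsup M Set.inter_subset_left γ hγ
    exact h1.trans (h m hm)
  obtain ⟨β, hβ⟩ := exists_isLeast_Lam (𝒴 := 𝒴) hπ hlt
  have hK : ∀ K, S ⊆ gammaSet (Lam π 𝒴) K → β ∈ gammaSet (Lam π 𝒴) K := fun K hK =>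
    mem_gammaSet_of_isLeast hβ (le_of_forall_lt fun γ hγ => by
      obtain ⟨m, hm, h1, h2⟩ := hsup K hK γ hγ
      exact h1.trans_le (le_csSup (bddAbove_inter_Iio _ _) ⟨hm, h2.trans_le hβ.1.2⟩))
  have hβS : β ∈ S := ⟨hK M Set.inter_subset_left, hK N Set.inter_subset_right⟩
  exact hδS (by
    rw [cmp, ← hS, (le_antisymm hβ.1.2 (le_csSup hbdd hβS) : sSup S = β)]
    exact hβS)

theorem le_cmp_of_le_sSup {M N : Set Ordinal.{u}} {δ : Ordinal.{u}} (hδ : δ < ω_ 2)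
    (hM : δ ≤ sSup (M ∩ Set.Iio δ)) (hN : δ ≤ sSup (N ∩ Set.Iio δ)) :
    δ ≤ cmp (Lam π 𝒴) M N := by
  obtain ⟨β, hβ⟩ := exists_isLeast_Lam (𝒴 := 𝒴) hπ hδ
  have h : ∀ K, δ ≤ sSup (K ∩ Set.Iio δ) → β ∈ gammaSet (Lam π 𝒴) K := fun K hK =>
    mem_gammaSet_of_isLeast hβ (hK.trans (sSup_inter_Iio_mono subset_rfl hβ.1.2))
  exact hβ.1.2.trans (le_cmp (h M hM) (h N hN))

theorem lt_cmp_of_mem {M N : Set Ordinal.{u}} {γ : Ordinal.{u}} (hγ : γ < ω_ 2)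
    (hM : γ + 1 ∈ M) (hN : γ + 1 ∈ N) : γ < cmp (Lam π 𝒴) M N := by
  obtain ⟨β, hβ⟩ := exists_isLeast_Lam (𝒴 := 𝒴) hπ (add_one_lt_omega_two hγ)
  -- A successor is never in `Λ`. This is why `γ + 1` is used: `γ` itself could be a point of `Λ`,
  -- and then the least `β` would not exceed it.
  have hlt : γ + 1 < β := by
    refine lt_of_le_of_ne hβ.1.2 fun e => ?_
    have := hβ.1.1.2.1
    rw [← e, Ordinal.cof_add_one] at this
    exact (Cardinal.one_lt_aleph0.trans_le (Cardinal.aleph0_le_aleph 1)).ne this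
  have h : ∀ K, γ + 1 ∈ K → β ∈ gammaSet (Lam π 𝒴) K := fun K hK =>
    mem_gammaSet_of_isLeast hβ (le_csSup (bddAbove_inter_Iio _ _) ⟨hK, hlt⟩)
  exact ((lt_add_one γ).trans hlt).trans_le (le_cmp (h M hM) (h N hN))

end Comparison

/-! ### Models -/

section Models

variable {π : Ordinal.{u} → ZFSet.{u}} {𝒴 : Set (Set Ordinal.{u})}

namespace Setting

variable (h : Setting π 𝒴) {L M N : Set Ordinal.{u}}

include h

theorem countable (hM : M ∈ models π 𝒴) : M.Countable := (h.stationary.subset M hM.1).2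

theorem add_one_mem (hM : M ∈ models π 𝒴) {α : Ordinal.{u}} (hα : α ∈ M) : α + 1 ∈ M := by
  have hlt := add_one_lt_omega_two (models_subset _ _ hM hα)
  rw [← hM.2.1]
  exact ⟨hlt, (isSkolemClosed_Sk _).succ_mem h.bijOn hlt (mem_SkO_of_mem hα)⟩

theorem infinite (hM : M ∈ models π 𝒴) (hne : M.Nonempty) : M.Infinite := fun hf => by
  obtain ⟨α, hα, hmax⟩ := hf.exists_maximal hne
  exact (hmax (h.add_one_mem hM hα) (lt_add_one α).le).not_gt (lt_add_one α)

/-- Closure of models under successor supplies the `γ + 1` needed in `lt_cmp_of_mem`. Several later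
contradictions exhibit a common ordinal at or above the comparison point. -/
theorem lt_cmp (hM : M ∈ models π 𝒴) (hN : N ∈ models π 𝒴) {γ : Ordinal.{u}} (h1 : γ ∈ M)
    (h2 : γ ∈ N) : γ < cmp (Lam π 𝒴) M N :=
  lt_cmp_of_mem h.bijOn (models_subset _ _ hM h1) (h.add_one_mem hM h1) (h.add_one_mem hN h2)

theorem cmp_mem (hM : M ∈ models π 𝒴) :
    cmp (Lam π 𝒴) M N ∈ gammaSet (Lam π 𝒴) M ∩ gammaSet (Lam π 𝒴) N :=
  AdequateForcing.cmp_mem h.bijOn (models_subset _ _ hM) (h.countable hM)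

theorem cmp_mem_Lam (hM : M ∈ models π 𝒴) : cmp (Lam π 𝒴) M N ∈ Lam π 𝒴 :=
  (h.cmp_mem hM).1.1.1

theorem inter_mem_models (hM : M ∈ models π 𝒴) {β : Ordinal.{u}} (hβ : β ∈ clubC π 𝒴) :
    M ∩ Set.Iio β ∈ models π 𝒴 := by
  refine ⟨h.initial M hM.1 β hβ.1, ?_, fun γ hγ => ⟨hM.2.2 γ hγ.1,
    (sSup_inter_Iio_le _ _).trans_lt hγ.2⟩⟩
  refine (subset_ordTrace_SkO (Set.inter_subset_left.trans (models_subset _ _ hM))).antisymm' ?_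
  refine Set.subset_inter ?_ ?_
  · exact (ordTrace_mono (SkO_mono Set.inter_subset_left)).trans hM.2.1.subset
  · exact (ordTrace_mono (SkO_mono Set.inter_subset_right)).trans hβ.2.subset

/-- Since `β` has cofinality `ω₁`, the countable cut is bounded by some `δ < β`. By thinness the
traces on `δ` have indices bounded by some `κ ∈ Sk(β)`, and `κ < β` because `β ∈ C`. -/
theorem cut_mem_SkO_Iio (hM : M ∈ 𝒴) {β : Ordinal.{u}} (hβ : β ∈ Lam π 𝒴) :
    ordCode (M ∩ Set.Iio β) ∈ SkO π 𝒴 (Set.Iio β) := by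
  obtain ⟨δ, hδ, hMδ⟩ : ∃ δ < β, M ∩ Set.Iio β ⊆ Set.Iio δ := by
    refine ⟨sSup ((· + 1) '' (M ∩ Set.Iio β)), Ordinal.sSup_add_one_lt_of_lt_cof ?_
      fun i hi => hi.2, fun i hi => ?_⟩
    · rw [← Ordinal.lift_cof, hβ.2.1]
      refine (Cardinal.mk_le_aleph0_iff.2
        ((h.stationary.subset M hM).2.mono Set.inter_subset_left).to_subtype).trans_lt ?_
      simp
    · refine (lt_add_one i).trans_le (le_csSup ⟨β, ?_⟩ (Set.mem_image_of_mem _ hi))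
      rintro _ ⟨j, hj, rfl⟩
      exact Order.add_one_le_of_lt hj.2
  have hδ2 : δ < ω_ 2 := hδ.trans hβ.1
  obtain ⟨κ, hκ, hκS, hb⟩ := (isSkolemClosed_Sk _).exists_index_bound h.bijOn h.stationary.subset
    (h.thin δ hδ2) hδ2 (mem_SkO_of_mem (π := π) (𝒴 := 𝒴) hδ)
  have hκβ : κ < β := (Lam_subset_clubC hβ).2.subset ⟨hκ, hκS⟩
  obtain ⟨ξ, hξ, e⟩ := hb M hM
  have : M ∩ Set.Iio β = M ∩ Set.Iio δ :=
    (Set.subset_inter Set.inter_subset_left hMδ).antisymm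
      (Set.inter_subset_inter_right M (Set.Iio_subset_Iio hδ.le))
  rw [this, ← e]
  exact (isSkolemClosed_Sk _).apply_mem h.bijOn (hξ.trans hκ) (mem_SkO_of_mem (hξ.trans hκβ))

theorem subset_of_mem_SkO (hL : L ∈ models π 𝒴) (hN : ordTrace (SkO π 𝒴 N) ⊆ N)
    (hLN : ordCode L ∈ SkO π 𝒴 N) : L ⊆ N := fun α hα =>
  hN ⟨models_subset _ _ hL hα, (isSkolemClosed_Sk _).mem_of_mem_code h.bijOn (models_subset _ _ hL)
    (h.countable hL) (h.infinite hL ⟨α, hα⟩) hLN hα⟩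

theorem cut_mem_SkO (hL : L ∈ models π 𝒴) (hLN : ordCode L ∈ SkO π 𝒴 N) (η : Ordinal.{u}) :
    ordCode (L ∩ Set.Iio η) ∈ SkO π 𝒴 N := by
  rcases L.eq_empty_or_nonempty with rfl | hne
  · rwa [Set.empty_inter]
  · exact (isSkolemClosed_Sk _).cut_mem h.bijOn (models_subset _ _ hL) (h.countable hL)
      (h.infinite hL hne) hLN η

/-- The cut lies in `Sk(N)` by `cut_mem_SkO` and in `Sk(η)` by thinness; `mem_SkO_inter` combines
the two. -/
theorem cut_mem_SkO_cut (hL : L ∈ models π 𝒴) (hN : N ∈ models π 𝒴)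
    (hLN : ordCode L ∈ SkO π 𝒴 N) {η : Ordinal.{u}} (hη : η ∈ Lam π 𝒴) :
    ordCode (L ∩ Set.Iio η) ∈ SkO π 𝒴 (N ∩ Set.Iio η) :=
  mem_SkO_inter h.bijOn hN.2.1.subset (Lam_subset_clubC hη).2.subset
    (ordCode_mem_H (Set.inter_subset_left.trans (models_subset _ _ hL))
      ((h.countable hL).mono Set.inter_subset_left))
    (h.cut_mem_SkO hL hLN η) (h.cut_mem_SkO_Iio hL.1 hη)

end Setting

variable (π 𝒴) in
/-- The trichotomy in the definition of adequacy, with `Sk` taken below `η`. -/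
def Rel (η : Ordinal.{u}) (M N : Set Ordinal.{u}) : Prop :=
  M ∩ Set.Iio η = N ∩ Set.Iio η ∨
    ordCode (M ∩ Set.Iio η) ∈ SkO π 𝒴 (N ∩ Set.Iio η) ∨
    ordCode (N ∩ Set.Iio η) ∈ SkO π 𝒴 (M ∩ Set.Iio η)

theorem Rel.symm {η : Ordinal.{u}} {M N : Set Ordinal.{u}} (h : Rel π 𝒴 η M N) :
    Rel π 𝒴 η N M := by
  rcases h with h | h | h
  exacts [Or.inl h.symm, Or.inr (Or.inr h), Or.inr (Or.inl h)]

variable (π 𝒴) in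
/-- The comparison demanded of two members of an adequate set. -/
def Comparable (M N : Set Ordinal.{u}) : Prop := Rel π 𝒴 (cmp (Lam π 𝒴) M N) M N

theorem Comparable.symm {M N : Set Ordinal.{u}} (h : Comparable π 𝒴 M N) :
    Comparable π 𝒴 N M := by
  rw [Comparable, cmp_comm]
  exact Rel.symm h

namespace Setting

variable (h : Setting π 𝒴) {L M N : Set Ordinal.{u}}

include h

/-- Equality restricts, and the membership cases follow from `cut_mem_SkO_cut`. Taking `η = δ`
replaces `Sk(N)` by the smaller `Sk(N ∩ δ)`. -/
theorem rel_of_le (hM : M ∈ models π 𝒴) (hN : N ∈ models π 𝒴) {η δ : Ordinal.{u}}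
    (hη : η ∈ Lam π 𝒴) (hδ : δ ∈ Lam π 𝒴) (hle : η ≤ δ)
    (hr : M ∩ Set.Iio δ = N ∩ Set.Iio δ ∨ ordCode (M ∩ Set.Iio δ) ∈ SkO π 𝒴 N ∨
      ordCode (N ∩ Set.Iio δ) ∈ SkO π 𝒴 M) : Rel π 𝒴 η M N := by
  have key : ∀ K : Set Ordinal.{u}, K ∩ Set.Iio δ ∩ Set.Iio η = K ∩ Set.Iio η := fun K => by
    rw [Set.inter_assoc, Set.inter_eq_right.2 (Set.Iio_subset_Iio hle)]
  have hδC := Lam_subset_clubC hδ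
  rcases hr with hr | hr | hr
  · exact Or.inl (by rw [← key M, hr, key])
  · refine Or.inr (Or.inl ?_)
    rw [← key M]
    exact h.cut_mem_SkO_cut (h.inter_mem_models hM hδC) hN hr hη
  · refine Or.inr (Or.inr ?_)
    rw [← key N]
    exact h.cut_mem_SkO_cut (h.inter_mem_models hN hδC) hM hr hη

theorem isAdequate_iff {A : Set (Set Ordinal.{u})} :
    IsAdequate π 𝒴 (Lam π 𝒴) A ↔ A ⊆ models π 𝒴 ∧ ∀ M ∈ A, ∀ N ∈ A, Comparable π 𝒴 M N := by
  refine and_congr_right fun hA => forall₄_congr fun M hM N hN => ⟨fun hr => ?_, fun hr => ?_⟩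
  · exact h.rel_of_le (hA hM) (hA hN) (h.cmp_mem_Lam (hA hM)) (h.cmp_mem_Lam (hA hM)) le_rfl hr
  · exact hr.imp_right (Or.imp (fun h => SkO_mono Set.inter_subset_left h)
      fun h => SkO_mono Set.inter_subset_left h)

theorem rel_of_comparable (hM : M ∈ models π 𝒴) (hN : N ∈ models π 𝒴)
    (hr : Comparable π 𝒴 M N) {η : Ordinal.{u}} (hη : η ∈ Lam π 𝒴)
    (hle : η ≤ cmp (Lam π 𝒴) M N) : Rel π 𝒴 η M N :=
  h.rel_of_le hM hN hη (h.cmp_mem_Lam hM) hle (hr.imp_right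
    (Or.imp (fun h => SkO_mono Set.inter_subset_left h)
      fun h => SkO_mono Set.inter_subset_left h))

theorem comparable_of_mem_SkO (hL : L ∈ models π 𝒴) (hN : N ∈ models π 𝒴)
    (hLN : ordCode L ∈ SkO π 𝒴 N) : Comparable π 𝒴 L N :=
  Or.inr (Or.inl (h.cut_mem_SkO_cut hL hN hLN (h.cmp_mem_Lam hL)))

end Setting

end Models

/-! ### Amalgamation of conditions -/

section Amalgamation

variable {π : Ordinal.{u} → ZFSet.{u}} {𝒴 : Set (Set Ordinal.{u})}

variable (π 𝒴) in
/-- The properties of a countable set `S` and its trace `N` on `ω₂` needed for amalgamation. -/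
structure IsGoodModel (S : Set ZFSet.{u}) (N : Set Ordinal.{u}) : Prop where
  mem_models : N ∈ models π 𝒴
  condEmb_mem_iff : ∀ p : Cond π 𝒴, condEmb π 𝒴 p ∈ S ↔
    (∀ M ∈ p.A, ordCode M ∈ SkO π 𝒴 N) ∧ ∀ x ∈ p.f, x.1 ∈ N ∧ x.2 ∈ N
  exists_model : ∀ e : Set ZFSet.{u}, e.Finite → e ⊆ SkO π 𝒴 N →
    ∃ K ∈ models π 𝒴, ordCode K ∈ SkO π 𝒴 N ∧ e ⊆ SkO π 𝒴 K
  cofinal : ∀ ζ ∈ N, ζ.cof ≤ ℵ₀ → ∀ γ < ζ, ∃ ξ ∈ N, γ ≤ ξ ∧ ξ < ζ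

theorem Rel.congr {η : Ordinal.{u}} {M N M' N' : Set Ordinal.{u}}
    (hM : M ∩ Set.Iio η = M' ∩ Set.Iio η) (hN : N ∩ Set.Iio η = N' ∩ Set.Iio η)
    (h : Rel π 𝒴 η M N) : Rel π 𝒴 η M' N' := by
  rwa [Rel, hM, hN] at h

theorem inter_Iio_inter_Iio (M : Set Ordinal.{u}) {η β : Ordinal.{u}} (h : η ≤ β) :
    M ∩ Set.Iio β ∩ Set.Iio η = M ∩ Set.Iio η := by
  rw [Set.inter_assoc, Set.inter_eq_right.2 (Set.Iio_subset_Iio h)]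

theorem inter_eq_of_cut {M K : Set Ordinal.{u}} (hX : M = K ∨ ∃ ζ ∈ Lam π 𝒴, M = K ∩ Set.Iio ζ) {η : Ordinal.{u}}
    (hη : η ∈ gammaSet (Lam π 𝒴) M) : M ∩ Set.Iio η = K ∩ Set.Iio η := by
  rcases hX with rfl | ⟨ζ, hζ, rfl⟩
  · rfl
  · exact inter_Iio_inter_Iio _ ((mem_gammaSet_inter_iff hζ).1 hη).2

/-- The remainder points of `N` over `M`. -/
def remainder (Γ N M : Set Ordinal.{u}) : Set Ordinal.{u} :=
  {ζ | ∃ b, (b ∈ M ∧ cmp Γ M N ≤ b ∨ b = cmp Γ M N ∧ N ∩ Set.Iio b ⊆ M) ∧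
    IsLeast {x | x ∈ N ∧ b ≤ x} ζ}

namespace Setting

variable (h : Setting π 𝒴) {L M N K : Set Ordinal.{u}}

include h

/-- Between two successive remainder points there is a bound `b ∈ M`, so an accumulation point `δ`
would be a limit of both `M` and `N`. Then `δ ≤ β_{M,N}`, although such `b` satisfy `β_{M,N} ≤ b <
δ`. -/
theorem finite_remainder (hN : N ∈ models π 𝒴) :
    (remainder (Lam π 𝒴) N M).Finite := by
  set β := cmp (Lam π 𝒴) M N with hβ
  set R : Set Ordinal.{u} := {ζ | ∃ b ∈ M, β ≤ b ∧ IsLeast {x | x ∈ N ∧ b ≤ x} ζ} with hR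
  have hsub : remainder (Lam π 𝒴) N M ⊆ R ∪ {ζ | IsLeast {x | x ∈ N ∧ β ≤ x} ζ} := by
    rintro ζ ⟨b, ⟨hb, hle⟩ | ⟨rfl, -⟩, hζ⟩
    · exact Or.inl ⟨b, hb, hle, hζ⟩
    · exact Or.inr hζ
  have hone : {ζ | IsLeast {x | x ∈ N ∧ β ≤ x} ζ}.Finite :=
    Set.Subsingleton.finite fun x hx y hy => IsLeast.unique hx hy
  refine (Set.Finite.union ?_ hone).subset hsub
  refine Set.not_infinite.1 fun hinf => ?_
  obtain ⟨κ, hκ, hNκ⟩ := exists_bound ((Cardinal.mk_le_aleph0_iff.2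
    (h.countable hN).to_subtype).trans (Cardinal.aleph0_le_aleph 1)) (models_subset _ _ hN)
  have hRN : R ⊆ N := by
    rintro ζ ⟨b, -, -, hζ⟩
    exact hζ.1.1
  let D : Set Ordinal.{u} := {δ | (R ∩ Set.Iio δ).Infinite}
  have hκD : κ ∈ D := by
    have : R ∩ Set.Iio κ = R := Set.inter_eq_left.2 fun ζ hζ => hNκ ζ (hRN hζ)
    rw [Set.mem_ofPred_eq, this]
    exact hinf
  have hδD : sInf D ∈ D := csInf_mem ⟨κ, hκD⟩
  set δ := sInf D with hδ
  have key : ∀ γ < δ, ∃ b ∈ M, ∃ ζ ∈ N, β ≤ b ∧ γ < b ∧ b < δ ∧ γ < ζ ∧ ζ < δ := by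
    intro γ hγ
    have hfin : (R ∩ Set.Iio γ).Finite := Set.not_infinite.1 fun hi => (csInf_le' hi).not_gt hγ
    -- By minimality of `δ` only finitely many points lie below `γ`. The bound producing the larger
    -- point `ζ₂` must exceed `ζ₁`.
    obtain ⟨ζ₁, ⟨⟨hζ₁, h1⟩, h1'⟩, ζ₂, ⟨⟨⟨b, hb, hβb, hζ₂⟩, h2⟩, -⟩, hlt⟩ :=
      (Set.Infinite.sdiff hδD hfin).nontrivial.exists_lt
    have hγ1 : γ ≤ ζ₁ := not_lt.1 fun hlt' => h1' ⟨hζ₁, hlt'⟩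
    have hb1 : ζ₁ < b := not_le.1 fun hle => (hζ₂.2 ⟨hRN hζ₁, hle⟩).not_gt hlt
    exact ⟨b, hb, ζ₂, hζ₂.1.1, hβb, hγ1.trans_lt hb1, hζ₂.1.2.trans_lt h2, hγ1.trans_lt hlt, h2⟩
  have hle : δ ≤ β := by
    refine le_cmp_of_le_sSup h.bijOn ((csInf_le' hκD).trans_lt hκ)
      (le_of_forall_lt fun γ hγ => ?_) (le_of_forall_lt fun γ hγ => ?_)
    · obtain ⟨b, hb, -, -, -, h1, h2, -⟩ := key γ hγ
      exact h1.trans_le (le_csSup (bddAbove_inter_Iio _ _) ⟨hb, h2⟩)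
    · obtain ⟨-, -, ζ, hζ, -, -, -, h1, h2⟩ := key γ hγ
      exact h1.trans_le (le_csSup (bddAbove_inter_Iio _ _) ⟨hζ, h2⟩)
  have hδ0 : 0 < δ := by
    rw [pos_iff_ne_zero]
    intro e
    rw [e] at hδD
    exact hδD (by simp)
  obtain ⟨b, -, -, -, h1, -, h2, -⟩ := key 0 hδ0
  exact ((h1.trans_lt h2).trans_le hle).false

/-- `N` has no element in `[b, ζ)`. Closure of models under `sup(C ∩ ·)` makes `ζ` a limit of `C`,
and `IsGoodModel.cofinal` excludes countable cofinality. -/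
theorem remainder_subset {S : Set ZFSet.{u}} (hS : IsGoodModel π 𝒴 S N) (hM : M ∈ models π 𝒴) :
    remainder (Lam π 𝒴) N M ⊆ N ∩ Lam π 𝒴 := by
  rintro ζ ⟨b, hb, hζ⟩
  have hN := hS.mem_models
  refine ⟨hζ.1.1, ?_⟩
  have hβ := h.cmp_mem_Lam (N := N) hM
  set β := cmp (Lam π 𝒴) M N with hβdef
  have hβb : β ≤ b := by
    rcases hb with ⟨-, hb⟩ | ⟨rfl, -⟩
    exacts [hb, le_rfl]
  have hNζ : ∀ x ∈ N, x < ζ → x < b := fun x hx hlt =>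
    not_le.1 fun hle => (hζ.2 ⟨hx, hle⟩).not_gt hlt
  -- When `ζ = b`, the bound cannot come from `M`, since it would be a common ordinal not below `β`;
  -- so it is `β`, a point of `Λ`.
  rcases hζ.1.2.eq_or_lt with rfl | hlt
  · rcases hb with ⟨hbM, -⟩ | ⟨e, -⟩
    · exact absurd (h.lt_cmp hM hN hbM hζ.1.1) hβb.not_gt
    · rwa [e]
  have hsN := hN.2.2 ζ hζ.1.1
  set s := sSup (clubC π 𝒴 ∩ Set.Iio ζ) with hs
  have hle : ∀ δ ∈ clubC π 𝒴, δ < ζ → δ ≤ s := fun δ hδ h' =>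
    le_csSup (bddAbove_inter_Iio _ _) ⟨hδ, h'⟩
  have hβs : β ≤ s := hle β (Lam_subset_clubC hβ) (hβb.trans_lt hlt)
  -- If `s < ζ`, then `s < b` as `s ∈ N`, so `s` is also `sup(C ∩ b)`. With `b ∈ M` this is a common
  -- ordinal not below `β`; with `b = β` it contradicts `β ≤ s`.
  rcases (sSup_inter_Iio_le (clubC π 𝒴) ζ).lt_or_eq with hsζ | hsζ
  · exfalso
    have hsb := hNζ s hsN hsζ
    rcases hb with ⟨hbM, -⟩ | ⟨rfl, -⟩
    · have e : clubC π 𝒴 ∩ Set.Iio ζ = clubC π 𝒴 ∩ Set.Iio b := by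
        ext δ
        exact and_congr_right fun hδ => ⟨fun h' => (hle δ hδ h').trans_lt hsb, fun h' =>
          lt_trans h' hlt⟩
      have hsM := hM.2.2 b hbM
      rw [← e, ← hs] at hsM
      exact (h.lt_cmp hM hN hsM hsN).not_ge hβs
    · exact hsb.not_ge hβs
  · have hζ2 := models_subset _ _ hN hζ.1.1
    refine ⟨hζ2, le_antisymm ((Ordinal.cof_le_card ζ).trans (card_le_of_lt_omega_two hζ2)) ?_,
      fun γ hγ => ?_⟩
    · rw [Cardinal.aleph_one_le_iff]
      by_contra hcof
      obtain ⟨ξ, hξ, h1, h2⟩ := hS.cofinal ζ hζ.1.1 (not_lt.1 hcof) b hlt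
      exact (hNζ ξ hξ h2).not_ge h1
    · rw [← hsζ] at hγ
      obtain ⟨δ, hδ, h'⟩ := exists_lt_of_lt_csSup' hγ
      exact ⟨δ, hδ.1, h', hδ.2⟩

/-- Pairs in a condition containing `N` do not straddle remainder points of `N`. -/
theorem lt_of_mem_remainder (hM : M ∈ models π 𝒴) (hN : N ∈ models π 𝒴) {ζ α γ : Ordinal.{u}}
    (hζ : ζ ∈ remainder (Lam π 𝒴) N M) (hα : α ∈ N) (hγ : γ ∈ N)
    (hmeets : (M ∩ Set.uIcc α γ).Nonempty → α ∈ M ∧ γ ∈ M) (hαζ : α < ζ) : γ < ζ := by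
  obtain ⟨b, hb, hζ⟩ := hζ
  by_contra hle
  have hαb : α < b := not_le.1 fun hle => (hζ.2 ⟨hα, hle⟩).not_gt hαζ
  have hbγ : b ≤ γ := hζ.1.2.trans (not_lt.1 hle)
  have hmem : b ∈ Set.uIcc α γ := Set.mem_uIcc.2 (Or.inl ⟨hαb.le, hbγ⟩)
  rcases hb with ⟨hbM, hβ⟩ | ⟨e, hsub⟩
  · exact ((h.lt_cmp hM hN (hmeets ⟨b, hbM, hmem⟩).2 hγ).trans_le (hβ.trans hbγ)).false
  · have := (hmeets ⟨α, hsub ⟨hα, hαb⟩, Set.left_mem_uIcc⟩).2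
    rw [e] at hbγ
    exact (h.lt_cmp hM hN this hγ).not_ge hbγ

/-- Adding the top model to a condition. -/
theorem exists_le_mem {S : Set ZFSet.{u}} (hS : IsGoodModel π 𝒴 S N) {p : Cond π 𝒴}
    (hp : condEmb π 𝒴 p ∈ S) : ∃ q ≤ p, N ∈ q.A := by
  obtain ⟨hA, hf⟩ := (hS.condEmb_mem_iff p).1 hp
  have hN := hS.mem_models
  have hpA := (h.isAdequate_iff.1 p.A_adequate)
  refine ⟨{
    f := p.f
    A := insert N p.A
    f_finite := p.f_finite
    f_subset := p.f_subset
    f_functional := p.f_functional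
    A_finite := p.A_finite.insert N
    A_adequate := h.isAdequate_iff.2 ⟨Set.insert_subset hN hpA.1, ?_⟩
    meets := ?_ }, ⟨Set.subset_insert _ _, subset_rfl⟩, Set.mem_insert _ _⟩
  · have key : ∀ M ∈ p.A, Comparable π 𝒴 M N := fun M hM =>
      h.comparable_of_mem_SkO (hpA.1 hM) hN (hA M hM)
    rintro M (rfl | hM) L (rfl | hL)
    · exact Or.inl rfl
    · exact (key L hL).symm
    · exact key M hM
    · exact hpA.2 M hM L hL
  · rintro M (rfl | hM) α γ hαγ hne
    · exact hf _ hαγ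
    · exact p.meets M hM α γ hαγ hne

/-- Traces of members of an adequate set on their comparison points with `N`, together with a
model `K` containing them and its initial segments, form an adequate set. -/
theorem comparable_restriction {A : Set (Set Ordinal.{u})} (hA : IsAdequate π 𝒴 (Lam π 𝒴) A)
    (hK : K ∈ models π 𝒴) {X Y : Set Ordinal.{u}}
    (hX : (∃ M ∈ A, X = M ∩ Set.Iio (cmp (Lam π 𝒴) M N) ∧ ordCode X ∈ SkO π 𝒴 K) ∨
      (X = K ∨ ∃ ζ ∈ Lam π 𝒴, X = K ∩ Set.Iio ζ))
    (hY : (∃ M ∈ A, Y = M ∩ Set.Iio (cmp (Lam π 𝒴) M N) ∧ ordCode Y ∈ SkO π 𝒴 K) ∨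
      (Y = K ∨ ∃ ζ ∈ Lam π 𝒴, Y = K ∩ Set.Iio ζ)) : Comparable π 𝒴 X Y := by
  have hA' := h.isAdequate_iff.1 hA
  have hmod : ∀ M ∈ A, M ∩ Set.Iio (cmp (Lam π 𝒴) M N) ∈ models π 𝒴 := fun M hM =>
    h.inter_mem_models (hA'.1 hM) (Lam_subset_clubC (h.cmp_mem_Lam (hA'.1 hM)))
  have hcut : ∀ {X}, (X = K ∨ ∃ ζ ∈ Lam π 𝒴, X = K ∩ Set.Iio ζ) → X ∈ models π 𝒴 := by
    rintro X (rfl | ⟨ζ, hζ, rfl⟩)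
    · exact hK
    · exact h.inter_mem_models hK (Lam_subset_clubC hζ)
  have mixed : ∀ {X Y}, (∃ M ∈ A, X = M ∩ Set.Iio (cmp (Lam π 𝒴) M N) ∧ ordCode X ∈ SkO π 𝒴 K) →
      (Y = K ∨ ∃ ζ ∈ Lam π 𝒴, Y = K ∩ Set.Iio ζ) → Comparable π 𝒴 X Y := by
    rintro X Y ⟨M, hM, rfl, hXK⟩ hY
    have hη := h.cmp_mem (N := Y) (hmod M hM)
    refine Or.inr (Or.inl ?_)
    rw [inter_eq_of_cut hY hη.2]
    exact h.cut_mem_SkO_cut (hmod M hM) hK hXK hη.1.1.1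
  rcases hX with hX | hX <;> rcases hY with hY | hY
  · obtain ⟨M, hM, rfl, -⟩ := hX
    obtain ⟨M', hM', rfl, -⟩ := hY
    have hη := h.cmp_mem (N := M' ∩ Set.Iio (cmp (Lam π 𝒴) M' N)) (hmod M hM)
    set η := cmp (Lam π 𝒴) (M ∩ Set.Iio (cmp (Lam π 𝒴) M N)) (M' ∩ Set.Iio (cmp (Lam π 𝒴) M' N))
      with hηdef
    obtain ⟨h1, h1'⟩ := (mem_gammaSet_inter_iff (h.cmp_mem_Lam (hA'.1 hM))).1 hη.1
    obtain ⟨h2, h2'⟩ := (mem_gammaSet_inter_iff (h.cmp_mem_Lam (hA'.1 hM'))).1 hη.2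
    -- The comparison point of two cuts is at most that of `M` and `M'`, so their comparison
    -- restricts to it.
    exact (h.rel_of_comparable (hA'.1 hM) (hA'.1 hM') (hA'.2 M hM M' hM') h1.1.1
      (le_cmp h1 h2)).congr (inter_Iio_inter_Iio M h1').symm (inter_Iio_inter_Iio M' h2').symm
  · exact mixed hX hY
  · exact (mixed hY hX).symm
  · have hη := h.cmp_mem (N := Y) (hcut hX)
    exact Or.inl ((inter_eq_of_cut hX hη.1).trans (inter_eq_of_cut hY hη.2).symm)

/-- A model in `Sk(N)` comparable with `M ∩ β_{M,N}` if this is in `Sk(N)` is comparable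
with `M`. -/
theorem comparable_of_mem_SkO_of_comparable (hM : M ∈ models π 𝒴) (hN : N ∈ models π 𝒴)
    (hL : L ∈ models π 𝒴) (hMN : Comparable π 𝒴 M N) (hLN : ordCode L ∈ SkO π 𝒴 N)
    (hr : ordCode (M ∩ Set.Iio (cmp (Lam π 𝒴) M N)) ∈ SkO π 𝒴 N →
      Comparable π 𝒴 L (M ∩ Set.Iio (cmp (Lam π 𝒴) M N))) : Comparable π 𝒴 L M := by
  have hη := h.cmp_mem (N := M) hL
  set η := cmp (Lam π 𝒴) L M with hηdef
  have hLsub := h.subset_of_mem_SkO hL hN.2.1.subset hLN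
  -- As `L ⊆ N`, each point of `Λ_L` is one of `Λ_N`; the comparison of `M` with `N` therefore
  -- covers `η`.
  have hle : η ≤ cmp (Lam π 𝒴) M N := le_cmp hη.2 (gammaSet_mono hLsub hη.1)
  have hηΛ := hη.1.1.1
  have hLη := h.cut_mem_SkO_cut hL hN hLN hηΛ
  rcases hMN with hMN | hMN | hMN
  · refine Or.inr (Or.inl ?_)
    have : M ∩ Set.Iio η = N ∩ Set.Iio η := by
      rw [← inter_Iio_inter_Iio M hle, hMN, inter_Iio_inter_Iio N hle]
    rwa [this]
  · have hMΛ := h.cmp_mem_Lam (N := N) hM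
    have := h.rel_of_comparable hL (h.inter_mem_models hM (Lam_subset_clubC hMΛ))
      (hr (SkO_mono Set.inter_subset_left hMN)) hηΛ
      (le_cmp hη.1 ((mem_gammaSet_inter_iff hMΛ).2 ⟨hη.2, hle⟩))
    exact this.congr rfl (inter_Iio_inter_Iio M hle)
  -- Here `N ∩ η` is a member, hence a subset, of `Sk(M ∩ η)`, so the hull of `N ∩ η`, which
  -- contains `L ∩ η`, is included in it.
  · refine Or.inr (Or.inl ?_)
    have hMη : M ∩ Set.Iio η ∈ models π 𝒴 := h.inter_mem_models hM (Lam_subset_clubC hηΛ)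
    have hNη : N ∩ Set.Iio η ∈ models π 𝒴 := h.inter_mem_models hN (Lam_subset_clubC hηΛ)
    have hmem : ordCode (N ∩ Set.Iio η) ∈ SkO π 𝒴 (M ∩ Set.Iio η) := by
      have := h.cut_mem_SkO_cut (h.inter_mem_models hN (Lam_subset_clubC (h.cmp_mem_Lam hM)))
        (h.inter_mem_models hM (Lam_subset_clubC (h.cmp_mem_Lam (N := N) hM))) hMN hηΛ
      rwa [inter_Iio_inter_Iio N hle, inter_Iio_inter_Iio M hle] at this
    exact SkO_mono (h.subset_of_mem_SkO hNη hMη.2.1.subset hmem) hLη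

/-- The amalgamation step: `v` records what `S` can see of `r`, with additional models that forbid
later pairs from crossing remainder points. -/
theorem exists_extension_of_restriction {S : Set ZFSet.{u}} (hS : IsGoodModel π 𝒴 S N)
    {r : Cond π 𝒴} (hNr : N ∈ r.A) : ∃ v : Cond π 𝒴, condEmb π 𝒴 v ∈ S ∧
      ∀ d ≤ v, condEmb π 𝒴 d ∈ S → ∃ t, t ≤ r ∧ t ≤ d := by
  have hN := hS.mem_models
  have hrA := h.isAdequate_iff.1 r.A_adequate
  set F : Set (Ordinal.{u} × Ordinal.{u}) := {x | x ∈ r.f ∧ x.1 ∈ N ∧ x.2 ∈ N} with hF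
  set A₀ : Set (Set Ordinal.{u}) := (fun M => M ∩ Set.Iio (cmp (Lam π 𝒴) M N)) ''
    {M | M ∈ r.A ∧ ordCode (M ∩ Set.Iio (cmp (Lam π 𝒴) M N)) ∈ SkO π 𝒴 N} with hA₀
  set R : Set Ordinal.{u} := ⋃ M ∈ r.A, remainder (Lam π 𝒴) N M with hR
  have hFfin : F.Finite := r.f_finite.subset fun x hx => hx.1
  have hA₀fin : A₀.Finite := (r.A_finite.subset fun M hM => hM.1).image _
  have hRfin : R.Finite := r.A_finite.biUnion fun M hM => h.finite_remainder hN
  have hRsub : R ⊆ N ∩ Lam π 𝒴 := Set.iUnion₂_subset fun M hM => h.remainder_subset hS (hrA.1 hM)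
  have hA₀mod : A₀ ⊆ models π 𝒴 := by
    rintro _ ⟨M, ⟨hM, -⟩, rfl⟩
    exact h.inter_mem_models (hrA.1 hM) (Lam_subset_clubC (h.cmp_mem_Lam (hrA.1 hM)))
  -- `K` lies in `Sk(N)`, so conditions in `S` may use it, and it captures the cuts, the remainder
  -- points and the end points of retained pairs.
  obtain ⟨K, hK, hKN, heK⟩ := hS.exists_model
    (ordCode '' A₀ ∪ (Ordinal.toZFSet '' R ∪ Ordinal.toZFSet '' (Prod.fst '' F ∪ Prod.snd '' F)))
    ((hA₀fin.image _).union ((hRfin.image _).union (((hFfin.image _).union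
      (hFfin.image _)).image _))) (by
      rintro _ (⟨_, ⟨M, ⟨-, hM⟩, rfl⟩, rfl⟩ | ⟨ζ, hζ, rfl⟩ | ⟨_, ⟨x, hx, rfl⟩ | ⟨x, hx, rfl⟩, rfl⟩)
      · exact hM
      · exact mem_SkO_of_mem (hRsub hζ).1
      · exact mem_SkO_of_mem hx.2.1
      · exact mem_SkO_of_mem hx.2.2)
  have hordK : ∀ α : Ordinal.{u}, α < ω_ 2 → α.toZFSet ∈ SkO π 𝒴 K → α ∈ K := fun α h1 h2 =>
    hK.2.1.subset ⟨h1, h2⟩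
  have hA₀K : ∀ L ∈ A₀, ordCode L ∈ SkO π 𝒴 K := fun L hL => heK (Or.inl ⟨L, hL, rfl⟩)
  have hRK : R ⊆ K := fun ζ hζ => hordK ζ (models_subset _ _ hN (hRsub hζ).1)
    (heK (Or.inr (Or.inl ⟨ζ, hζ, rfl⟩)))
  have hFK : ∀ x ∈ F, x.1 ∈ K ∧ x.2 ∈ K := fun x hx =>
    ⟨hordK _ (models_subset _ _ hN hx.2.1) (heK (Or.inr (Or.inr ⟨_, Or.inl ⟨x, hx, rfl⟩, rfl⟩))),
      hordK _ (models_subset _ _ hN hx.2.2) (heK (Or.inr (Or.inr ⟨_, Or.inr ⟨x, hx, rfl⟩, rfl⟩)))⟩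
  have hKcut : ∀ ζ ∈ R, K ∩ Set.Iio ζ ∈ models π 𝒴 := fun ζ hζ =>
    h.inter_mem_models hK (Lam_subset_clubC (hRsub hζ).2)
  set B : Set (Set Ordinal.{u}) := A₀ ∪ insert K ((fun ζ => K ∩ Set.Iio ζ) '' R) with hB
  have hBform : ∀ X ∈ B, (∃ M ∈ r.A, X = M ∩ Set.Iio (cmp (Lam π 𝒴) M N) ∧
      ordCode X ∈ SkO π 𝒴 K) ∨ (X = K ∨ ∃ ζ ∈ Lam π 𝒴, X = K ∩ Set.Iio ζ) := by
    rintro X (hX | rfl | ⟨ζ, hζ, rfl⟩)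
    · obtain ⟨M, hM, rfl⟩ := id hX
      exact Or.inl ⟨M, hM.1, rfl, hA₀K _ hX⟩
    · exact Or.inr (Or.inl rfl)
    · exact Or.inr (Or.inr ⟨ζ, (hRsub hζ).2, rfl⟩)
  have hBN : ∀ X ∈ B, ordCode X ∈ SkO π 𝒴 N := by
    rintro X (⟨M, hM, rfl⟩ | rfl | ⟨ζ, hζ, rfl⟩)
    · exact hM.2
    · exact hKN
    · exact h.cut_mem_SkO hK hKN ζ
  have hBmod : B ⊆ models π 𝒴 := Set.union_subset hA₀mod (Set.insert_subset hK (by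
    rintro _ ⟨ζ, hζ, rfl⟩
    exact hKcut ζ hζ))
  -- pairs in `F` do not straddle points of `R`
  have hFR : ∀ ζ ∈ R, ∀ α γ, (α, γ) ∈ F → (α < ζ ↔ γ < ζ) := by
    intro ζ hζ α γ hαγ
    obtain ⟨M, hM, hζM⟩ := Set.mem_iUnion₂.1 hζ
    have hmeets := r.meets M hM α γ hαγ.1
    exact ⟨h.lt_of_mem_remainder (hrA.1 hM) hN hζM hαγ.2.1 hαγ.2.2 hmeets,
      h.lt_of_mem_remainder (hrA.1 hM) hN hζM hαγ.2.2 hαγ.2.1 (by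
        rw [Set.uIcc_comm]
        exact fun hne => (hmeets hne).symm)⟩
  let v : Cond π 𝒴 :=
    { f := F
      A := B
      f_finite := hFfin
      f_subset := fun x hx => r.f_subset hx.1
      f_functional := fun α γ γ' h1 h2 => r.f_functional α γ γ' h1.1 h2.1
      A_finite := hA₀fin.union ((hRfin.image _).insert K)
      A_adequate := h.isAdequate_iff.2 ⟨hBmod, fun X hX Y hY =>
        h.comparable_restriction r.A_adequate hK (hBform X hX) (hBform Y hY)⟩
      meets := by
        rintro X (⟨M, hM, rfl⟩ | rfl | ⟨ζ, hζ, rfl⟩) α γ hαγ ⟨ξ, hξ, hξ'⟩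
        -- The end points are in `M ∩ N`, hence below `β_{M,N}`.
        · obtain ⟨h1, h2⟩ := r.meets M hM.1 α γ hαγ.1 ⟨ξ, hξ.1, hξ'⟩
          exact ⟨⟨h1, h.lt_cmp (hrA.1 hM.1) hN h1 hαγ.2.1⟩,
            ⟨h2, h.lt_cmp (hrA.1 hM.1) hN h2 hαγ.2.2⟩⟩
        · exact hFK _ hαγ
        · have hiff := hFR ζ hζ α γ hαγ
          have hlt : α < ζ ∧ γ < ζ := by
            rcases Set.mem_uIcc.1 hξ' with h' | h'
            · have h1 := h'.1.trans_lt hξ.2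
              exact ⟨h1, hiff.1 h1⟩
            · have h1 := h'.1.trans_lt hξ.2
              exact ⟨hiff.2 h1, h1⟩
          exact ⟨⟨(hFK _ hαγ).1, hlt.1⟩, ⟨(hFK _ hαγ).2, hlt.2⟩⟩ }
  refine ⟨v, (hS.condEmb_mem_iff v).2 ⟨hBN, fun x hx => hx.2⟩, fun d hdv hdS => ?_⟩
  obtain ⟨hdA, hdf⟩ := (hS.condEmb_mem_iff d).1 hdS
  obtain ⟨hBd, hFd⟩ : B ⊆ d.A ∧ F ⊆ d.f := hdv
  have hdad := h.isAdequate_iff.1 d.A_adequate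
  -- pairs in `d` do not straddle points of `R`
  have hdR : ∀ ζ ∈ R, ∀ α γ, (α, γ) ∈ d.f ∨ (γ, α) ∈ d.f → α < ζ → γ < ζ := by
    intro ζ hζ α γ hαγ hα
    by_contra hγ
    rw [not_lt] at hγ
    have hmeets : ∀ X ∈ d.A, (X ∩ Set.uIcc α γ).Nonempty → α ∈ X ∧ γ ∈ X := fun X hX => by
      rcases hαγ with hαγ | hαγ
      · exact d.meets X hX α γ hαγ
      · rw [Set.uIcc_comm]
        exact fun hne => (d.meets X hX γ α hαγ hne).symm
    -- First `K` meets the interval at `ζ`, giving `α ∈ K`; then `K ∩ ζ` meets it at `α`, forcing `γ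
    -- < ζ`.
    have hαK := (hmeets K (hBd (Or.inr (Set.mem_insert _ _)))
      ⟨ζ, hRK hζ, Set.mem_uIcc.2 (Or.inl ⟨hα.le, hγ⟩)⟩).1
    exact (hmeets _ (hBd (Or.inr (Or.inr ⟨ζ, hζ, rfl⟩))) ⟨α, ⟨hαK, hα⟩,
      Set.left_mem_uIcc⟩).2.2.not_ge hγ
  have hcross : ∀ L ∈ d.A, ∀ M ∈ r.A, Comparable π 𝒴 L M := fun L hL M hM =>
    h.comparable_of_mem_SkO_of_comparable (hrA.1 hM) hN (hdad.1 hL) (hrA.2 M hM N hNr) (hdA L hL)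
      fun hMN => hdad.2 L hL _ (hBd (Or.inl ⟨M, ⟨hM, hMN⟩, rfl⟩))
  have hold : ∀ α γ, (α, γ) ∈ r.f → (N ∩ Set.uIcc α γ).Nonempty → (α, γ) ∈ d.f :=
    fun α γ hαγ hne => hFd ⟨hαγ, r.meets N hNr α γ hαγ hne⟩
  -- a model of `r` meeting the interval of a pair of `d` contains its end points
  have hnew : ∀ M ∈ r.A, ∀ α γ, (α, γ) ∈ d.f ∨ (γ, α) ∈ d.f → α ≤ γ → α ∈ N → γ ∈ N →
      (M ∩ Set.Icc α γ).Nonempty → α ∈ M ∧ γ ∈ M := by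
    rintro M hM α γ hαγ hle hαN hγN ⟨ξ, hξM, hξ⟩
    set β := cmp (Lam π 𝒴) M N with hβ
    have hrem : remainder (Lam π 𝒴) N M ⊆ R := Set.subset_biUnion_of_mem hM
    have hsmall : ordCode (M ∩ Set.Iio β) ∈ SkO π 𝒴 N → ξ < β → α ∈ M ∧ γ ∈ M := fun hMN hξβ => by
      have hmem : M ∩ Set.Iio β ∈ d.A := hBd (Or.inl ⟨M, ⟨hM, hMN⟩, rfl⟩)
      have : ξ ∈ Set.uIcc α γ := Set.mem_uIcc.2 (Or.inl hξ)
      rcases hαγ with hαγ | hαγ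
      · have := d.meets _ hmem α γ hαγ ⟨ξ, ⟨hξM, hξβ⟩, this⟩
        exact ⟨this.1.1, this.2.1⟩
      · rw [Set.uIcc_comm] at this
        have := d.meets _ hmem γ α hαγ ⟨ξ, ⟨hξM, hξβ⟩, this⟩
        exact ⟨this.2.1, this.1.1⟩
    -- A pair crossing an admissible bound `b` also crosses the remainder point `min(N \ b)`, which
    -- exists and is at most `γ` because `γ ∈ N`.
    have hnost : ∀ b, (b ∈ M ∧ β ≤ b ∨ b = β ∧ N ∩ Set.Iio b ⊆ M) → α < b → b ≤ γ → False := by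
      intro b hb hαb hbγ
      have hne : {x | x ∈ N ∧ b ≤ x}.Nonempty := ⟨γ, hγN, hbγ⟩
      have hleast := isLeast_csInf hne
      exact (hdR _ (hrem ⟨b, hb, hleast⟩) α γ hαγ (hαb.trans_le hleast.1.2)).not_ge
        (hleast.2 ⟨hγN, hbγ⟩)
    by_cases hξβ : ξ < β
    · have hlarge : N ∩ Set.Iio β ⊆ M → α ∈ M ∧ γ ∈ M := fun hsub => by
        by_cases hγβ : γ < β
        · exact ⟨hsub ⟨hαN, hle.trans_lt hγβ⟩, hsub ⟨hγN, hγβ⟩⟩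
        · exact (hnost β (Or.inr ⟨rfl, hsub⟩) (hξ.1.trans_lt hξβ) (not_lt.1 hγβ)).elim
      rcases hrA.2 M hM N hNr with hMN | hMN | hMN
      · exact hlarge (hMN ▸ Set.inter_subset_left)
      · exact hsmall (SkO_mono Set.inter_subset_left hMN) hξβ
      · have hNβ := h.inter_mem_models hN (Lam_subset_clubC (h.cmp_mem_Lam (N := N) (hrA.1 hM)))
        exact hlarge (h.subset_of_mem_SkO hNβ (hrA.1 hM).2.1.subset
          (SkO_mono Set.inter_subset_left hMN))
    · rw [not_lt] at hξβ
      -- For `ξ = α` the point would be common to `M` and `N` yet not below `β`; otherwise `ξ`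
      -- itself is a crossed bound.
      rcases hξ.1.eq_or_lt with rfl | hlt
      · exact absurd (h.lt_cmp (hrA.1 hM) hN hξM hαN) hξβ.not_gt
      · exact (hnost ξ (Or.inl ⟨hξM, hξβ⟩) hlt hξ.2).elim
  refine ⟨{
    f := r.f ∪ d.f
    A := r.A ∪ d.A
    f_finite := r.f_finite.union d.f_finite
    f_subset := Set.union_subset r.f_subset d.f_subset
    f_functional := ?_
    A_finite := r.A_finite.union d.A_finite
    A_adequate := h.isAdequate_iff.2 ⟨Set.union_subset hrA.1 hdad.1, ?_⟩
    meets := ?_ }, ⟨Set.subset_union_left, Set.subset_union_left⟩,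
    ⟨Set.subset_union_right, Set.subset_union_right⟩⟩
  · have key : ∀ α γ γ', (α, γ) ∈ r.f → (α, γ') ∈ d.f → γ = γ' := fun α γ γ' h1 h2 =>
      d.f_functional α γ γ' (hold α γ h1 ⟨α, (hdf _ h2).1, Set.left_mem_uIcc⟩) h2
    rintro α γ γ' (h1 | h1) (h2 | h2)
    · exact r.f_functional α γ γ' h1 h2
    · exact key α γ γ' h1 h2
    · exact (key α γ' γ h2 h1).symm
    · exact d.f_functional α γ γ' h1 h2
  · rintro L (hL | hL) M (hM | hM)
    · exact hrA.2 L hL M hM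
    · exact (hcross M hM L hL).symm
    · exact hcross L hL M hM
    · exact hdad.2 L hL M hM
  · rintro M (hM | hM) α γ (hαγ | hαγ) hne
    · exact r.meets M hM α γ hαγ hne
    · obtain ⟨hαN, hγN⟩ := hdf _ hαγ
      rcases le_total α γ with hle | hle
      · rw [Set.uIcc_of_le hle] at hne
        exact hnew M hM α γ (Or.inl hαγ) hle hαN hγN hne
      · rw [Set.uIcc_of_ge hle] at hne
        exact (hnew M hM γ α (Or.inr hαγ) hle hγN hαN hne).symm
    · have hMN := h.subset_of_mem_SkO (hdad.1 hM) hN.2.1.subset (hdA M hM)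
      exact d.meets M hM α γ (hold α γ hαγ (hne.mono (Set.inter_subset_inter_left _ hMN))) hne
    · exact d.meets M hM α γ hαγ hne

theorem isStronglyGeneric {S : Set ZFSet.{u}} (hS : IsGoodModel π 𝒴 S N) {q : Cond π 𝒴}
    (hq : N ∈ q.A) : IsStronglyGeneric (condEmb π 𝒴) S q := by
  intro D hD r hr
  obtain ⟨v, hv, hvd⟩ := h.exists_extension_of_restriction hS (hr.1 hq)
  obtain ⟨d, hd, hdv⟩ := hD.2 v hv
  obtain ⟨t, htr, htd⟩ := hvd d hdv (hD.1 hd)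
  exact ⟨d, hd, t, htr, htd⟩

end Setting

end Amalgamation

/-! ### Existence of good models -/

section Existence

variable {π : Ordinal.{u} → ZFSet.{u}} {𝒴 : Set (Set Ordinal.{u})}

variable (π 𝒴) in
/-- Closure under these operations makes the trace of a set on `ω₂` a model. -/
def modelValues (e : Finset ZFSet.{u}) : Set ZFSet.{u} :=
  skolemValues π 𝒴 e ∪ {z | ∃ γ < ω_ 2, γ.toZFSet ∈ e ∧
    z = (sSup (clubC π 𝒴 ∩ Set.Iio γ)).toZFSet}

variable (π 𝒴) in
/-- The ordinals and models from which a condition is built. -/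
def pieces (p : Cond π 𝒴) : Set ZFSet.{u} :=
  ordCode '' p.A ∪ (Ordinal.toZFSet '' (Prod.fst '' p.f) ∪ Ordinal.toZFSet '' (Prod.snd '' p.f))

theorem finite_pieces (p : Cond π 𝒴) : (pieces π 𝒴 p).Finite :=
  (p.A_finite.image _).union (((p.f_finite.image _).image _).union ((p.f_finite.image _).image _))

theorem ordCode_mem_pieces {p : Cond π 𝒴} {M : Set Ordinal.{u}} (h : M ∈ p.A) :
    ordCode M ∈ pieces π 𝒴 p := Or.inl ⟨M, h, rfl⟩

theorem fst_mem_pieces {p : Cond π 𝒴} {x : Ordinal.{u} × Ordinal.{u}} (h : x ∈ p.f) :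
    x.1.toZFSet ∈ pieces π 𝒴 p := Or.inr (Or.inl ⟨_, ⟨x, h, rfl⟩, rfl⟩)

theorem snd_mem_pieces {p : Cond π 𝒴} {x : Ordinal.{u} × Ordinal.{u}} (h : x ∈ p.f) :
    x.2.toZFSet ∈ pieces π 𝒴 p := Or.inr (Or.inr ⟨_, ⟨x, h, rfl⟩, rfl⟩)

theorem finite_setOf_pieces_subset {e : Set ZFSet.{u}} (he : e.Finite) :
    {p : Cond π 𝒴 | pieces π 𝒴 p ⊆ e}.Finite := by
  have hO : (Ordinal.toZFSet ⁻¹' e).Finite := he.preimage Ordinal.toZFSet_injective.injOn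
  have hM : (models π 𝒴 ∩ ordCode ⁻¹' e).Finite :=
    Set.Finite.of_finite_image (f := ordCode) (he.subset (by
      rintro _ ⟨M, hM, rfl⟩
      exact hM.2)) fun M hM N hN h =>
        ordCode_inj (models_subset _ _ hM.1) (models_subset _ _ hN.1) h
  refine Set.Finite.of_finite_image (f := fun p : Cond π 𝒴 => (p.f, p.A))
    (((hO.prod hO).finite_subsets.prod hM.finite_subsets).subset ?_) fun p _ q _ h =>
      Cond.ext (Prod.mk.inj h).1 (Prod.mk.inj h).2
  rintro _ ⟨p, hp, rfl⟩
  exact ⟨fun x hx => ⟨hp (fst_mem_pieces hx), hp (snd_mem_pieces hx)⟩,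
    fun M hM => ⟨p.A_adequate.1 hM, hp (ordCode_mem_pieces hM)⟩⟩

theorem ordTrace_hull_subset {T : Finset ZFSet.{u} → Set ZFSet.{u}} {a : Set Ordinal.{u}}
    (ha : a ⊆ Set.Iio (ω_ 2)) : a ⊆ ordTrace (hull T (ordClass a)) := fun _ h =>
  ⟨ha h, subset_hull _ (Set.mem_image_of_mem _ h)⟩

theorem exists_countable_cofinal {ζ : Ordinal.{u}} (h : ζ.cof ≤ ℵ₀) :
    ∃ s : Set Ordinal.{u}, s.Countable ∧ s ⊆ Set.Iio ζ ∧ ∀ γ < ζ, ∃ ξ ∈ s, γ ≤ ξ := by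
  obtain ⟨s, hs, hc⟩ := Order.exists_cof_eq (Set.Iio ζ)
  refine ⟨Subtype.val '' s, Set.Countable.image ?_ _, ?_, fun γ hγ => ?_⟩
  · rw [← Cardinal.le_aleph0_iff_set_countable, hc, Ordinal.cof_Iio, ← Ordinal.lift_cof,
      Cardinal.lift_le_aleph0]
    exact h
  · rintro _ ⟨x, -, rfl⟩
    exact x.2
  · obtain ⟨ξ, hξ, hle⟩ := hs ⟨γ, hγ⟩
    exact ⟨ξ, ⟨ξ, hξ, rfl⟩, hle⟩

namespace Setting

variable (h : Setting π 𝒴)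

include h

/-- Stationarity of `𝒴` is applied here, to the club of `isClubIn_trace`. -/
theorem exists_trace_hull {T : Finset ZFSet.{u} → Set ZFSet.{u}} (hT : ∀ e, (T e).Countable) :
    ∃ a ∈ 𝒴, ordTrace (hull T (ordClass a)) = a := by
  obtain ⟨a, ha, hsub, -, htr⟩ := h.stationary.meets _ (isClubIn_trace (Set.Iio (ω_ 2))
    Ordinal.toZFSet hT Ordinal.toZFSet_injective.injOn)
  exact ⟨a, ha, Set.Subset.antisymm htr (ordTrace_hull_subset hsub)⟩

theorem countable_modelValues (e : Finset ZFSet.{u}) : (modelValues π 𝒴 e).Countable := by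
  -- Rank recovers an ordinal from its code, so the second part is contained in an image of `e`.
  refine (countable_skolemValues h.bijOn e).union (Set.Countable.mono ?_
    (e.countable_toSet.image fun x => (sSup (clubC π 𝒴 ∩ Set.Iio x.rank)).toZFSet))
  rintro _ ⟨γ, -, hγ, rfl⟩
  exact ⟨_, hγ, by simp only [Ordinal.rank_toZFSet]⟩

omit h in
theorem modelValues_subset_H (e : Finset ZFSet.{u}) : modelValues π 𝒴 e ⊆ H (ℵ_ 2) := by
  rintro _ (⟨n, φ, x, y, -, -, rfl⟩ | ⟨γ, hγ, -, rfl⟩)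
  · exact y.val_mem
  · exact toZFSet_mem_H ((sSup_inter_Iio_le _ _).trans_lt hγ)

/-- Traces of suitably closed sets on `ω₂` are models. -/
theorem mem_models_of_closed {S : Set ZFSet.{u}} (hS : IsClosedUnder (modelValues π 𝒴) S)
    (h𝒴 : ordTrace S ∈ 𝒴) : ordTrace S ∈ models π 𝒴 ∧ S ∩ H (ℵ_ 2) = SkO π 𝒴 (ordTrace S) := by
  have hsk : IsSkolemClosed π 𝒴 S := isSkolemClosed_iff.2 (hS.mono fun e => Set.subset_union_left)
  have hsub : SkO π 𝒴 (ordTrace S) ⊆ S := Sk_subset (by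
    rintro _ ⟨α, hα, rfl⟩
    exact hα.2) hsk
  refine ⟨⟨h𝒴, (ordTrace_mono hsub).antisymm (subset_ordTrace_SkO (ordTrace_subset_Iio S)),
    fun γ hγ => ⟨(sSup_inter_Iio_le _ _).trans_lt hγ.1, ?_⟩⟩, ?_⟩
  · exact hS {γ.toZFSet} (by simpa using hγ.2) (Or.inr ⟨γ, hγ.1, by simp, rfl⟩)
  · refine Set.Subset.antisymm ?_ (Set.subset_inter hsub (SkO_subset_H (ordTrace_subset_Iio S)))
    rintro x ⟨hxS, hx⟩
    obtain ⟨ξ, hξ, rfl⟩ := h.bijOn.surjOn hx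
    exact (isSkolemClosed_Sk _).apply_mem h.bijOn hξ
      (mem_SkO_of_mem ⟨hξ, hsk.index_mem h.bijOn hξ hxS⟩)

/-- Adding `e` to every value of the operation makes each closed set contain it. -/
theorem exists_model_superset {e : Finset ZFSet.{u}} (he : (e : Set ZFSet.{u}) ⊆ H (ℵ_ 2)) :
    ∃ K ∈ models π 𝒴, (e : Set ZFSet.{u}) ⊆ SkO π 𝒴 K := by
  obtain ⟨a, ha, htr⟩ := h.exists_trace_hull (T := fun e' => modelValues π 𝒴 e' ∪ e)
    fun e' => (h.countable_modelValues e').union e.countable_toSet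
  have hcl := isClosedUnder_hull (T := fun e' => modelValues π 𝒴 e' ∪ e) (ordClass a)
  obtain ⟨h1, h2⟩ := h.mem_models_of_closed (hcl.mono fun e => Set.subset_union_left)
    (by rwa [htr])
  rw [htr] at h1 h2
  refine ⟨a, h1, fun x hx => ?_⟩
  rw [← h2]
  exact ⟨hcl ∅ (by simp) (Or.inr hx), he hx⟩

theorem pieces_subset_H (p : Cond π 𝒴) : pieces π 𝒴 p ⊆ H (ℵ_ 2) := by
  rintro _ (⟨M, hM, rfl⟩ | ⟨_, ⟨x, hx, rfl⟩, rfl⟩ | ⟨_, ⟨x, hx, rfl⟩, rfl⟩)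
  · exact ordCode_mem_H (models_subset _ _ (p.A_adequate.1 hM)) (h.countable (p.A_adequate.1 hM))
  · exact toZFSet_mem_H (p.f_subset hx).1
  · exact toZFSet_mem_H (p.f_subset hx).2

/-- There are good models closed under any given finitary operations. -/
theorem exists_isGoodModel {T : Finset ZFSet.{u} → Set ZFSet.{u}} (hT : ∀ e, (T e).Countable)
    {X : Set ZFSet.{u}} (hHX : H (ℵ_ 2) ⊆ X) (hQX : Set.range (condEmb π 𝒴) ⊆ X)
    (hTX : IsClosedUnder T X) : ∃ S N, S ⊆ X ∧ S.Countable ∧ IsClosedUnder T S ∧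
      N = ordTrace S ∧ IsGoodModel π 𝒴 S N := by
  classical
  choose! K hK hKe using fun (e : Finset ZFSet.{u}) (he : (e : Set ZFSet.{u}) ⊆ H (ℵ_ 2)) =>
    h.exists_model_superset he
  choose! c hc hcsub hccof using fun (ζ : Ordinal.{u}) (hζ : ζ.cof ≤ ℵ₀) =>
    exists_countable_cofinal hζ
  -- `T₁` and `T₂` take conditions apart and reassemble them, `T₃` supplies the models `K`, and `T₄`
  -- supplies cofinal sets for ordinals of countable cofinality: one operation for each clause of
  -- `IsGoodModel`.
  let T₁ : Finset ZFSet.{u} → Set ZFSet.{u} := fun e => ⋃ p ∈ condEmb π 𝒴 ⁻¹' e, pieces π 𝒴 p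
  let T₂ : Finset ZFSet.{u} → Set ZFSet.{u} := fun e => condEmb π 𝒴 '' {p | pieces π 𝒴 p ⊆ e}
  let T₃ : Finset ZFSet.{u} → Set ZFSet.{u} := fun e =>
    {z | (e : Set ZFSet.{u}) ⊆ H (ℵ_ 2) ∧ z = ordCode (K e)}
  let T₄ : Finset ZFSet.{u} → Set ZFSet.{u} := fun e =>
    ⋃ ζ ∈ {ζ : Ordinal.{u} | ζ.toZFSet ∈ e ∧ ζ < ω_ 2 ∧ ζ.cof ≤ ℵ₀}, Ordinal.toZFSet '' c ζ
  let T' : Finset ZFSet.{u} → Set ZFSet.{u} := fun e =>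
    modelValues π 𝒴 e ∪ (T₁ e ∪ (T₂ e ∪ (T₃ e ∪ (T₄ e ∪ T e))))
  have hT' : ∀ e, (T' e).Countable := fun e => by
    refine (h.countable_modelValues e).union (Set.Countable.union ?_ (Set.Countable.union ?_
      (Set.Countable.union ?_ (Set.Countable.union ?_ (hT e)))))
    · exact (Set.Finite.biUnion (e.finite_toSet.preimage (condEmb π 𝒴).injective.injOn)
        fun p _ => finite_pieces p).countable
    · exact ((finite_setOf_pieces_subset e.finite_toSet).image _).countable
    · exact Set.Subsingleton.countable fun x hx y hy => hx.2.trans hy.2.symm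
    · refine Set.Countable.biUnion (Set.Finite.countable ?_) fun ζ hζ => (hc ζ hζ.2.2).image _
      exact (e.finite_toSet.preimage Ordinal.toZFSet_injective.injOn).subset fun ζ hζ => hζ.1
  have hXT' : IsClosedUnder T' X := by
    intro e he
    refine Set.union_subset ((modelValues_subset_H e).trans hHX) (Set.union_subset
      (Set.iUnion₂_subset fun p _ => (h.pieces_subset_H p).trans hHX) (Set.union_subset
      ((Set.image_subset_range _ _).trans hQX) (Set.union_subset ?_
      (Set.union_subset ?_ (hTX e he)))))
    · rintro _ ⟨he', rfl⟩
      exact hHX (ordCode_mem_H (models_subset _ _ (hK e he')) (h.countable (hK e he')))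
    · refine Set.iUnion₂_subset fun ζ hζ => ?_
      rintro _ ⟨ξ, hξ, rfl⟩
      exact hHX (toZFSet_mem_H ((hcsub ζ hζ.2.2 hξ).trans hζ.2.1))
  obtain ⟨a, ha, htr⟩ := h.exists_trace_hull hT'
  have haB := (h.stationary.subset a ha)
  have hcl := isClosedUnder_hull (T := T') (ordClass a)
  set S := hull T' (ordClass a) with hS
  have hcl₁ : IsClosedUnder T₁ S := hcl.mono fun e x hx => Or.inr (Or.inl hx)
  have hcl₂ : IsClosedUnder T₂ S := hcl.mono fun e x hx => Or.inr (Or.inr (Or.inl hx))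
  have hcl₃ : IsClosedUnder T₃ S := hcl.mono fun e x hx => Or.inr (Or.inr (Or.inr (Or.inl hx)))
  have hcl₄ : IsClosedUnder T₄ S := hcl.mono fun e x hx =>
    Or.inr (Or.inr (Or.inr (Or.inr (Or.inl hx))))
  obtain ⟨h1, h2⟩ := h.mem_models_of_closed (hcl.mono fun e => Set.subset_union_left)
    (by rwa [htr])
  rw [htr] at h1 h2
  have hSk : ∀ x, x ∈ SkO π 𝒴 a ↔ x ∈ S ∧ x ∈ H (ℵ_ 2) := fun x => by rw [← h2]; rfl
  refine ⟨S, a, hull_subset ?_ hXT', countable_hull hT' (haB.2.image _),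
    hcl.mono fun e x hx => Or.inr (Or.inr (Or.inr (Or.inr (Or.inr hx)))), htr.symm, h1,
    fun p => ⟨fun hp => ?_, fun hp => ?_⟩, fun e hefin he => ?_, fun ζ hζ hcof γ hγ => ?_⟩
  · rintro _ ⟨α, hα, rfl⟩
    exact hHX (toZFSet_mem_H (haB.1 hα))
  · have hpS : pieces π 𝒴 p ⊆ S := (Set.subset_biUnion_of_mem (u := fun p => pieces π 𝒴 p)
      (show p ∈ condEmb π 𝒴 ⁻¹' ({condEmb π 𝒴 p} : Finset ZFSet.{u}) by simp)).trans
      (hcl₁ {condEmb π 𝒴 p} (by simpa using hp))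
    refine ⟨fun M hM => (hSk _).2 ⟨hpS (ordCode_mem_pieces hM),
      h.pieces_subset_H p (ordCode_mem_pieces hM)⟩, fun x hx => ?_⟩
    rw [← htr]
    exact ⟨⟨(p.f_subset hx).1, hpS (fst_mem_pieces hx)⟩,
      ⟨(p.f_subset hx).2, hpS (snd_mem_pieces hx)⟩⟩
  · refine hcl₂ (finite_pieces p).toFinset ?_ ⟨p, by simp, rfl⟩
    rw [Set.Finite.coe_toFinset]
    rintro _ (⟨M, hM, rfl⟩ | ⟨_, ⟨x, hx, rfl⟩, rfl⟩ | ⟨_, ⟨x, hx, rfl⟩, rfl⟩)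
    · exact ((hSk _).1 (hp.1 M hM)).1
    · exact subset_hull _ (Set.mem_image_of_mem _ (hp.2 x hx).1)
    · exact subset_hull _ (Set.mem_image_of_mem _ (hp.2 x hx).2)
  · have heS : (hefin.toFinset : Set ZFSet.{u}) ⊆ S := by
      rw [Set.Finite.coe_toFinset]
      exact fun x hx => ((hSk x).1 (he hx)).1
    have heH : (hefin.toFinset : Set ZFSet.{u}) ⊆ H (ℵ_ 2) := by
      rw [Set.Finite.coe_toFinset]
      exact fun x hx => ((hSk x).1 (he hx)).2
    refine ⟨K hefin.toFinset, hK _ heH, (hSk _).2 ⟨hcl₃ _ heS ⟨heH, rfl⟩,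
      ordCode_mem_H (models_subset _ _ (hK _ heH)) (h.countable (hK _ heH))⟩, ?_⟩
    have := hKe _ heH
    rwa [Set.Finite.coe_toFinset] at this
  · obtain ⟨ξ, hξ, hle⟩ := hccof ζ hcof γ hγ
    have hξζ := hcsub ζ hcof hξ
    refine ⟨ξ, ?_, hle, hξζ⟩
    rw [← htr]
    refine ⟨lt_trans hξζ (haB.1 hζ), hcl₄ {ζ.toZFSet} ?_ ?_⟩
    · rw [Finset.coe_singleton, Set.singleton_subset_iff]
      exact subset_hull _ (Set.mem_image_of_mem Ordinal.toZFSet hζ)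
    · exact Set.mem_biUnion (show ζ ∈ {ζ' : Ordinal.{u} | ζ'.toZFSet ∈ ({ζ.toZFSet} :
        Finset ZFSet.{u}) ∧ ζ' < ω_ 2 ∧ ζ'.cof ≤ ℵ₀} from ⟨by simp, haB.1 hζ, hcof⟩)
        ⟨ξ, hξ, rfl⟩

end Setting

/-! ### Elementary substructures of `H(θ)` and strong properness -/

instance : Countable (Σ n, setLang.BoundedFormula Empty n) := by
  have : Countable setLang.Symbols := by
    have h1 : Countable (Σ l, setLang.Functions l) := ⟨fun x => x.2.elim, fun x => x.2.elim⟩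
    have h2 : Countable (Σ l, setLang.Relations l) := by
      have : ∀ l, Countable (setLang.Relations l) := fun l =>
        ⟨fun _ => 0, fun (r : SetRel l) (s : SetRel l) _ => by cases r; cases s; rfl⟩
      infer_instance
    exact inferInstanceAs (Countable ((Σ l, setLang.Functions l) ⊕ (Σ l, setLang.Relations l)))
  refine Cardinal.mk_le_aleph0_iff.1 (FirstOrder.Language.BoundedFormula.card_le.trans ?_)
  have : setLang.card ≤ ℵ₀ := Cardinal.mk_le_aleph0_iff.2 this
  simp [this]

/-- The Tarski–Vaught test, with one witness chosen for each formula and parameter tuple whenever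
there is one. -/
theorem exists_elementary_operation (X : Set ZFSet.{u}) :
    ∃ T : Finset ZFSet.{u} → Set ZFSet.{u}, (∀ e, (T e).Countable) ∧ IsClosedUnder T X ∧
      ∀ S ⊆ X, IsClosedUnder T S → IsElementaryIn X S := by
  classical
  have hc : ∀ n, Countable (setLang.BoundedFormula Empty n) := fun n =>
    (sigma_mk_injective (i := n) : Function.Injective
      (Sigma.mk n : setLang.BoundedFormula Empty n → _)).countable
  have hw : ∀ (n : ℕ) (φ : setLang.BoundedFormula Empty (n + 1)) (x : Fin n → X),
      ∃ s : Set X, s.Countable ∧ ((∃ a, φ.Realize default (Fin.snoc x a : Fin (n + 1) → X)) →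
        ∃ a ∈ s, φ.Realize default (Fin.snoc x a : Fin (n + 1) → X)) := by
    intro n φ x
    by_cases hx : ∃ a, φ.Realize default (Fin.snoc x a : Fin (n + 1) → X)
    · obtain ⟨a, ha⟩ := hx
      exact ⟨{a}, Set.countable_singleton a, fun _ => ⟨a, rfl, ha⟩⟩
    · exact ⟨∅, Set.countable_empty, fun h => absurd h hx⟩
  choose w hwc hws using hw
  refine ⟨fun e => ⋃ (n : ℕ) (φ : setLang.BoundedFormula Empty (n + 1))
    (x : Fin n → {x : X // x.1 ∈ e}), Subtype.val '' w n φ fun i => (x i).1, fun e => ?_,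
    fun e _ => ?_, fun S hSX hS => ?_⟩
  · have he : Countable {x : X // x.1 ∈ e} :=
      (Function.Injective.countable (f := fun x : {x : X // x.1 ∈ e} =>
        (⟨x.1.1, x.2⟩ : e)) fun a b h => Subtype.ext (Subtype.ext (Subtype.mk.inj h)))
    exact Set.countable_iUnion fun n => Set.countable_iUnion fun φ =>
      Set.countable_iUnion fun x => (hwc _ _ _).image _
  · refine Set.iUnion_subset fun n => Set.iUnion_subset fun φ => Set.iUnion_subset fun x => ?_
    rintro _ ⟨a, -, rfl⟩
    exact a.2
  · let S' : setLang.Substructure X :=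
      { carrier := {x | x.1 ∈ S}
        fun_mem := fun f => Empty.elim f }
    have hel : S'.IsElementary := by
      refine S'.isElementary_of_exists fun n φ x a ha => ?_
      obtain ⟨b, hb, hφ⟩ := hws n φ (fun i => (x i : X)) ⟨a, ha⟩
      let e : Finset ZFSet.{u} := Finset.univ.image fun i => (x i : X).1
      have he : (e : Set ZFSet.{u}) ⊆ S := by
        intro z hz
        obtain ⟨i, -, rfl⟩ := Finset.mem_image.1 (Finset.mem_coe.1 hz)
        exact (x i).2
      refine ⟨⟨b, hS e he ?_⟩, hφ⟩
      simp only [Set.mem_iUnion]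
      exact ⟨n, φ, fun i => ⟨x i, Finset.mem_image_of_mem _ (Finset.mem_univ i)⟩, b, hb, rfl⟩
    refine ⟨⟨S', hel⟩, ?_⟩
    ext z
    constructor
    · intro hz
      exact ⟨⟨z, hSX hz⟩, hz, rfl⟩
    · rintro ⟨x, hx, rfl⟩
      exact hx

theorem Setting.stronglyProper (h : Setting π 𝒴) :
    StronglyProperOnStationarySet (condEmb π 𝒴) := by
  refine ⟨ℵ_ 2, fun θ hθ _ hQ => ⟨?_, fun 𝒞 h𝒞 => ?_⟩⟩
  · rintro N ⟨hc, ⟨S, rfl⟩, -⟩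
    refine ⟨?_, hc⟩
    rintro _ ⟨x, -, rfl⟩
    exact x.2
  · obtain ⟨T, hTc, hTX, hT⟩ := exists_elementary_operation (H θ)
    obtain ⟨T', hTc', hTX', hT'⟩ := h𝒞.exists_closedUnder
    obtain ⟨S, N, hSX, hSc, hcl, -, hgood⟩ := h.exists_isGoodModel (T := fun e => T e ∪ T' e)
      (fun e => (hTc e).union (hTc' e)) (H_mono hθ) hQ
      fun e he => Set.union_subset (hTX e he) (hTX' e he)
    refine ⟨S, ⟨hSc, hT S hSX (hcl.mono fun e => Set.subset_union_left), fun p hp => ?_⟩,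
      hT' S hSX hSc (hcl.mono fun e => Set.subset_union_right)⟩
    obtain ⟨q, hqp, hNq⟩ := h.exists_le_mem hgood hp
    exact ⟨q, hqp, h.isStronglyGeneric hgood hNq⟩

end Existence


/-! ### The forcing relation and preservation of `ω₁` -/

section Names

variable {Q : Type v} [Preorder Q]

theorem forcesEq_mono {x y : Name.{u, v} Q} {p q : Q} (hq : q ≤ p) (h : forcesEq x y p) :
    forcesEq x y q := by
  cases x
  cases y
  rw [forcesEq] at h ⊢
  exact ⟨fun i r hr => h.1 i r (hr.trans hq), fun j r hr => h.2 j r (hr.trans hq)⟩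

theorem forcesEq_refl (x : Name.{u, v} Q) (p : Q) : forcesEq x x p := by
  induction x generalizing p with
  | mk ι x a ih =>
    rw [forcesEq]
    exact ⟨fun i q _ hqa => ⟨q, le_rfl, i, hqa, ih i q⟩, fun i q _ hqa => ⟨q, le_rfl, i, hqa, ih i q⟩⟩

theorem forcesEq_symm {x y : Name.{u, v} Q} {p : Q} (h : forcesEq x y p) : forcesEq y x p := by
  induction x generalizing y p with
  | mk ι x a ih =>
    obtain ⟨κ, y, b⟩ := y
    rw [forcesEq] at h ⊢
    constructor
    · intro j q hq hqb
      obtain ⟨r, hr, i, hra, he⟩ := h.2 j q hq hqb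
      exact ⟨r, hr, i, hra, ih i he⟩
    · intro i q hq hqa
      obtain ⟨r, hr, j, hrb, he⟩ := h.1 i q hq hqa
      exact ⟨r, hr, j, hrb, ih i he⟩

theorem forcesEq_trans {x y z : Name.{u, v} Q} {p : Q} (h : forcesEq x y p)
    (h' : forcesEq y z p) : forcesEq x z p := by
  induction x generalizing y z p with
  | mk ι x a ih =>
    obtain ⟨κ, y, b⟩ := y
    obtain ⟨μ, z, c⟩ := z
    rw [forcesEq] at h h' ⊢
    constructor
    · intro i q hq hqa
      obtain ⟨r, hr, j, hrb, he⟩ := h.1 i q hq hqa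
      obtain ⟨s, hs, k, hsc, he'⟩ := h'.1 j r (hr.trans hq) hrb
      exact ⟨s, hs.trans hr, k, hsc, ih i (forcesEq_mono hs he) he'⟩
    · intro k q hq hqc
      obtain ⟨r, hr, j, hrb, he'⟩ := h'.2 k q hq hqc
      obtain ⟨s, hs, i, hsa, he⟩ := h.2 j r (hr.trans hq) hrb
      exact ⟨s, hs.trans hr, i, hsa, ih i he (forcesEq_mono hs he')⟩

theorem forcesMem_mono {x y : Name.{u, v} Q} {p q : Q} (hq : q ≤ p) (h : forcesMem x y p) :
    forcesMem x y q := by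
  cases y
  exact fun r hr => h r (hr.trans hq)

theorem forcesMem_of_eq_right {x y z : Name.{u, v} Q} {p : Q} (h : forcesMem x y p)
    (he : forcesEq y z p) : forcesMem x z p := by
  obtain ⟨κ, y, b⟩ := y
  obtain ⟨μ, z, c⟩ := z
  rw [forcesEq] at he
  intro q hq
  obtain ⟨r, hr, j, hrb, hx⟩ := h q hq
  obtain ⟨s, hs, k, hsc, hyz⟩ := he.1 j r (hr.trans hq) hrb
  exact ⟨s, hs.trans hr, k, hsc, forcesEq_trans (forcesEq_mono hs hx) hyz⟩

theorem fOr_mono {φ ψ φ' ψ' : Statement Q} {p : Q} (hφ : ∀ q ≤ p, φ q → φ' q)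
    (hψ : ∀ q ≤ p, ψ q → ψ' q) (h : fOr φ ψ p) : fOr φ' ψ' p := fun q hq => by
  obtain ⟨r, hr, hor⟩ := h q hq
  exact ⟨r, hr, hor.imp (hφ r (hr.trans hq)) (hψ r (hr.trans hq))⟩

theorem fIff_congr_right {φ ψ ψ' : Statement Q} {p : Q} (h : ∀ q ≤ p, ψ q ↔ ψ' q)
    (hφ : fIff φ ψ p) : fIff φ ψ' p :=
  ⟨fun q hq hq' => (h q hq).1 (hφ.1 q hq hq'), fun q hq hq' => hφ.2 q hq ((h q hq).2 hq')⟩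

theorem fIsUPair_congr {w x x' y y' : Name.{u, v} Q} {p : Q} (hx : forcesEq x x' p)
    (hy : forcesEq y y' p) (h : fIsUPair w x y p) : fIsUPair w x' y' p := fun u =>
  fIff_congr_right (fun _ hq =>
    ⟨fOr_mono (fun _ hr hu => forcesEq_trans hu (forcesEq_mono (hr.trans hq) hx))
      fun _ hr hu => forcesEq_trans hu (forcesEq_mono (hr.trans hq) hy),
    fOr_mono (fun _ hr hu => forcesEq_trans hu (forcesEq_symm (forcesEq_mono (hr.trans hq) hx)))
      fun _ hr hu => forcesEq_trans hu (forcesEq_symm (forcesEq_mono (hr.trans hq) hy))⟩) (h u)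

theorem fIsPair_congr_left {w x x' y : Name.{u, v} Q} {p : Q} (hx : forcesEq x x' p)
    (h : fIsPair w x y p) : fIsPair w x' y p := fun u =>
  fIff_congr_right (fun q hq => by
    have key : ∀ {x x'}, forcesEq x x' p → fOr (fIsUPair u x x) (fIsUPair u x y) q →
        fOr (fIsUPair u x' x') (fIsUPair u x' y) q := fun hx =>
      fOr_mono
        (fun r hr => fIsUPair_congr (forcesEq_mono (hr.trans hq) hx)
          (forcesEq_mono (hr.trans hq) hx))
        fun r hr => fIsUPair_congr (forcesEq_mono (hr.trans hq) hx) (forcesEq_refl y r)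
    exact ⟨key hx, key (forcesEq_symm hx)⟩) (h u)

theorem fPairMem_mono {f x y : Name.{u, v} Q} {p q : Q} (hq : q ≤ p) (h : fPairMem f x y p) :
    fPairMem f x y q := fun r hr => h r (hr.trans hq)

theorem fPairMem_congr_left {f x x' y : Name.{u, v} Q} {p : Q} (hx : forcesEq x x' p)
    (h : fPairMem f x y p) : fPairMem f x' y p := fun q hq => by
  obtain ⟨r, hr, z, hz, hp⟩ := h q hq
  exact ⟨r, hr, z, hz, fIsPair_congr_left (forcesEq_mono (hr.trans hq) hx) hp⟩

variable [OrderTop Q]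

theorem forcesMem_checkOrd {x : Name.{u, v} Q} {α : Ordinal.{u}} {p : Q}
    (h : forcesMem x (checkOrd α) p) : ∃ q ≤ p, ∃ β < α, forcesEq x (checkOrd β) q := by
  rw [checkOrd] at h
  obtain ⟨r, hr, i, -, he⟩ := h p le_rfl
  exact ⟨r, hr, _, (Ordinal.ToType.toOrd i).2, he⟩

theorem checkOrd_mem {α β : Ordinal.{u}} (h : β < α) (p : Q) :
    forcesMem (checkOrd β : Name.{u, v} Q) (checkOrd α) p := by
  rw [checkOrd.eq_def α]
  intro q _
  refine ⟨q, le_rfl, Ordinal.ToType.mk ⟨β, h⟩, le_top, ?_⟩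
  simpa using forcesEq_refl _ q

/-- If `α < β`, then `α̌` is forced into `β̌ = α̌`, so an extension forces `α̌ = γ̌` with `γ < α`,
contrary to the induction hypothesis; the other case is symmetric. -/
theorem checkOrd_injective {α β : Ordinal.{u}} {p : Q}
    (h : forcesEq (checkOrd α : Name.{u, v} Q) (checkOrd β) p) : α = β := by
  induction α using WellFoundedLT.induction generalizing β p with
  | ind α ih =>
    rcases lt_trichotomy α β with hlt | rfl | hlt
    · obtain ⟨q, -, γ, hγ, he⟩ := forcesMem_checkOrd
        (forcesMem_of_eq_right (checkOrd_mem hlt p) (forcesEq_symm h))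
      exact absurd (ih γ hγ (forcesEq_symm he)) hγ.ne
    · rfl
    · obtain ⟨q, -, γ, hγ, he⟩ := forcesMem_checkOrd
        (forcesMem_of_eq_right (checkOrd_mem hlt p) h)
      exact absurd (ih β hlt he) hγ.ne'

/-- If there are enough countable sets with strongly generic conditions, then `ω₁` is
preserved. -/
theorem preservesCardinal_omega_one (e : Q ↪ ZFSet.{u})
    (hQ : ∀ T : Finset ZFSet.{u} → Set ZFSet.{u}, (∀ a, (T a).Countable) →
      ∃ S : Set ZFSet.{u}, S.Countable ∧ IsClosedUnder T S ∧
        ∀ p ∈ inter e S, ∃ q ≤ p, IsStronglyGeneric e S q) :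
    PreservesCardinal.{u} Q (ω_ 1) := by
  classical
  rintro p x q - hx f r hr ⟨-, htot, hfun, hsurj⟩
  obtain ⟨r₁, hr₁, α, hα, hxα⟩ := forcesMem_checkOrd (forcesMem_mono hr hx)
  have hαc : (Set.Iio α).Countable := by
    rw [← Cardinal.le_aleph0_iff_set_countable, Cardinal.mk_Iio_ordinal, Cardinal.lift_le_aleph0]
    rwa [← Cardinal.lt_aleph_one_iff, ← Cardinal.lt_ord, Cardinal.ord_aleph]
  let Dec : Ordinal.{u} → Ordinal.{u} → Q → Prop := fun β η s =>
    ∃ y, forcesEq y (checkOrd η) s ∧ fPairMem f (checkOrd β) y s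
  have hdec : ∀ s ≤ r₁, ∀ β < α, ∃ t ≤ s, ∃ η, Dec β η t := by
    intro s hs β hβ
    have hmem : forcesMem (checkOrd β) x s :=
      forcesMem_of_eq_right (checkOrd_mem hβ s) (forcesEq_symm (forcesEq_mono hs hxα))
    obtain ⟨t, ht, y, hy, hp⟩ := htot (checkOrd β) s (hs.trans hr₁) hmem s le_rfl
    obtain ⟨t', ht', η, -, he⟩ := forcesMem_checkOrd hy
    exact ⟨t', ht'.trans ht, η, y, he, fPairMem_mono ht' hp⟩
  -- The operation must be total, so conditions incompatible with `r₁` receive dummy values.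
  have hext : ∀ (s : Q) (β : Ordinal.{u}), ∃ t : Q, ∃ η : Ordinal.{u},
      (∃ s' ≤ s, s' ≤ r₁) → β < α → t ≤ s ∧ Dec β η t := by
    intro s β
    by_cases h : (∃ s' ≤ s, s' ≤ r₁) ∧ β < α
    · obtain ⟨⟨s', hs', hr'⟩, hβ⟩ := h
      obtain ⟨t, ht, η, hη⟩ := hdec s' hr' β hβ
      exact ⟨t, η, fun _ _ => ⟨ht.trans hs', hη⟩⟩
    · exact ⟨s, 0, fun h1 h2 => absurd ⟨h1, h2⟩ h⟩
  choose t η hη using hext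
  obtain ⟨S, hSc, hScl, hS⟩ := hQ (fun a => {e r₁} ∪ ⋃ s ∈ e ⁻¹' a, ⋃ β ∈ Set.Iio α,
    {e (t s β), (η s β).toZFSet}) fun a => (Set.countable_singleton _).union
      ((a.finite_toSet.preimage e.injective.injOn).countable.biUnion fun s _ =>
        hαc.biUnion fun β _ => (Set.toFinite _).countable)
  have hr₁S : e r₁ ∈ S := hScl ∅ (by simp) (Or.inl rfl)
  have hclosed : ∀ s, e s ∈ S → ∀ β < α, e (t s β) ∈ S ∧ (η s β).toZFSet ∈ S := by
    intro s hs β hβ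
    have : ({e (t s β), (η s β).toZFSet} : Set ZFSet.{u}) ⊆ S := by
      refine subset_trans ?_ (hScl {e s} (by simpa using hs))
      intro z hz
      refine Or.inr (Set.mem_biUnion (x := s) (by simp) (Set.mem_biUnion (x := β) hβ hz))
    exact ⟨this (Or.inl rfl), this (Or.inr rfl)⟩
  -- `δ` will be a value of `f` that the countable set `S` cannot account for.
  obtain ⟨δ, hδ, hδS⟩ : ∃ δ < ω_ 1, δ.toZFSet ∉ S := by
    by_contra! hall
    have hc : (Set.Iio (ω_ 1 : Ordinal.{u})).Countable :=
      Set.countable_of_injective_of_countable_image Ordinal.toZFSet_injective.injOn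
        (hSc.mono (by
          rintro _ ⟨δ, hδ, rfl⟩
          exact hall δ hδ))
    rw [← Cardinal.le_aleph0_iff_set_countable, Cardinal.mk_Iio_ordinal, Cardinal.lift_le_aleph0,
      ← Cardinal.ord_aleph, Cardinal.card_ord] at hc
    exact hc.not_gt (Cardinal.aleph0_lt_aleph_one)
  obtain ⟨q', hq', hgen⟩ := hS r₁ hr₁S
  obtain ⟨s, hs, z, hz, hzδ⟩ := hsurj (checkOrd δ) q' (hq'.trans hr₁) (checkOrd_mem hδ q') q' le_rfl
  obtain ⟨s', hs', β, hβ, hzβ⟩ := forcesMem_checkOrd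
    (forcesMem_of_eq_right hz (forcesEq_mono (hs.trans hq') hxα))
  -- Only conditions compatible with `r₁` can be extended to decide `f(β)`; admitting the
  -- incompatible ones makes `D` dense in all of `S ∩ Q`.
  let D : Set Q := {d | d ∈ inter e S ∧
    ((¬ ∃ d' ≤ d, d' ≤ r₁) ∨ ∃ ξ : Ordinal.{u}, ξ.toZFSet ∈ S ∧ Dec β ξ d)}
  have hD : IsDenseSubset (inter e S) D := by
    refine ⟨fun d hd => hd.1, fun p hp => ?_⟩
    by_cases hc : ∃ d' ≤ p, d' ≤ r₁
    · obtain ⟨h1, h2⟩ := hη p β hc hβ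
      obtain ⟨h3, h4⟩ := hclosed p hp β hβ
      exact ⟨t p β, ⟨h3, Or.inr ⟨_, h4, h2⟩⟩, h1⟩
    · exact ⟨p, ⟨hp, Or.inl hc⟩, le_rfl⟩
  obtain ⟨d, ⟨-, hd⟩, w, hws, hwd⟩ := hgen D hD s' (hs'.trans hs)
  have hwr : w ≤ r₁ := hws.trans (hs'.trans (hs.trans hq'))
  rcases hd with hd | ⟨ξ, hξ, y, hyξ, hβy⟩
  · exact hd ⟨w, hwd, hwr⟩
  -- `w` forces both `ξ` and `δ` to be the value at `β`, so `δ = ξ` lies in `S`.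
  · have h1 : fPairMem f (checkOrd β) (checkOrd δ) w :=
      fPairMem_congr_left (forcesEq_mono hws hzβ) (fPairMem_mono (hws.trans hs') hzδ)
    have h2 := hfun (checkOrd β) y (checkOrd δ) w (hwr.trans hr₁)
      ⟨fPairMem_mono hwd hβy, h1⟩
    have h3 := checkOrd_injective
      (forcesEq_trans (forcesEq_symm (forcesEq_mono hwd hyξ)) h2)
    rw [h3] at hξ
    exact hδS hξ

end Names

variable {π : Ordinal.{u} → ZFSet.{u}} {𝒴 : Set (Set Ordinal.{u})}

/-- Only closure under the given operation is required of `S`, so the ambient set can be the whole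
universe and no `θ` is chosen. -/
theorem Setting.preservesCardinal (h : Setting π 𝒴) :
    PreservesCardinal.{u} (Cond π 𝒴) (ω_ 1) := by
  refine preservesCardinal_omega_one (condEmb π 𝒴) fun T hT => ?_
  obtain ⟨S, N, -, hSc, hcl, -, hgood⟩ := h.exists_isGoodModel hT (Set.subset_univ _)
    (Set.subset_univ _) fun _ _ => Set.subset_univ _
  refine ⟨S, hSc, hcl, fun p hp => ?_⟩
  obtain ⟨q, hqp, hNq⟩ := h.exists_le_mem hgood hp
  exact ⟨q, hqp, h.isStronglyGeneric hgood hNq⟩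

end AdequateForcing

theorem proposition5p2
    (hpow : (2 : Cardinal.{u}) ^ (ℵ_ 1 : Cardinal.{u}) = ℵ_ 2)
    (π : Ordinal.{u} → ZFSet.{u})
    (hπ : Set.BijOn π (Set.Iio (ω_ 2)) (AdequateForcing.H (ℵ_ 2)))
    (𝒴 : Set (Set Ordinal.{u}))
    (hstat : AdequateForcing.IsStationaryIn (Set.Iio (ω_ 2)) 𝒴)
    (hthin : ∀ β < ω_ 2, Cardinal.mk ((fun a => a ∩ Set.Iio β) '' 𝒴) ≤ ℵ_ 1)
    (hinit : ∀ a ∈ 𝒴, ∀ β < ω_ 2, a ∩ Set.Iio β ∈ 𝒴) :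
    AdequateForcing.StronglyProperOnStationarySet (AdequateForcing.condEmb π 𝒴) ∧
      AdequateForcing.PreservesCardinal.{u} (AdequateForcing.Cond π 𝒴) (ω_ 1) :=
  have h : AdequateForcing.Setting π 𝒴 := ⟨hπ, hstat, hthin, hinit⟩
  ⟨h.stronglyProper, h.preservesCardinal⟩
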